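/- Let $K$ be a field of arbitrary characteristic, let $k$ be a natural number and let $F_1,\dots,F_k$ be finitely generated non-abelian free Lie algebras over $K$. Let $L\le F_1\oplus\dots\oplus F_k$ be a subdirect sum, i.e. a Lie subalgebra that projects onto every $F_i$, such that $L\cap F_i\neq 0$ for all $1\le i\le k$. Assume that $L$ is finitely generated as a Lie algebra and that $\dim_K H_2(L,K)<\infty$, where $H_2(L,K)=\operatorname{Tor}_2^{\mathcal U(L)}(K,K)$, $\mathcal U(L)$ is the universal enveloping algebra of $L$ and $K$ is the trivial module. Then a) $p_{i,j}(L)=F_i\oplus F_j$ for all $1\le i<j\le k$, where $p_{i,j}\colon F_1\oplus\dots\oplus F_k\to F_i\oplus F_j$ is the canonical projection; b) $\gamma_{k-1}(F_i)\subseteq L$ for every $1\le i\le k$, where $\gamma_1(F)=F$ and $\gamma_j(F)=[F,\gamma_{j-1}(F)]$ for $j\ge 2$ (and, for $k=1$, $\gamma_0(F)=F$). -/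

import Mathlib

open scoped DirectSum
open CategoryTheory

universe u v

noncomputable section

namespace LieHomology

variable (K : Type u) [Field K] (L : Type v) [LieRing L] [LieAlgebra K L]

attribute [local instance] ModuleCat.moduleOfAlgebraModule
  ModuleCat.isScalarTower_of_algebra_moduleCat

attribute [local instance 100] LieRing.ofAssociativeRing

/-- The augmentation `U(L) → K` of the universal enveloping algebra, which sends `L` to `0`. -/
def augmentation : UniversalEnvelopingAlgebra K L →ₐ[K] K :=
  UniversalEnvelopingAlgebra.lift K (0 : L →ₗ⁅K⁆ K)

/-- The trivial `U(L)`-module `K`, on which `L` acts as `0`. -/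
def trivialModule : ModuleCat.{max u v} (UniversalEnvelopingAlgebra K L) :=
  (ModuleCat.restrictScalars (augmentation K L).toRingHom).obj (ModuleCat.of K (ULift.{v} K))

/-- The `K`-subspace of a `U(L)`-module `V` spanned by all `a • v - ε(a) • v`, where `ε` is the
augmentation. -/
def relations (V : ModuleCat.{max u v} (UniversalEnvelopingAlgebra K L)) : Submodule K V :=
  Submodule.span K
    {y | ∃ (a : UniversalEnvelopingAlgebra K L) (v : V), y = a • v - augmentation K L a • v}

variable {K L} in
lemma relations_le_comap {V W : ModuleCat.{max u v} (UniversalEnvelopingAlgebra K L)}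
    (f : V ⟶ W) :
    relations K L V ≤ (relations K L W).comap (f.hom.restrictScalars K) := by
  refine Submodule.span_le.2 ?_
  rintro _ ⟨a, v, rfl⟩
  refine Submodule.subset_span ⟨a, f.hom v, ?_⟩
  rw [map_sub, map_smul (f.hom.restrictScalars K)]
  simp

/-- The functor `V ↦ K ⊗_{U(L)} V` from left `U(L)`-modules to `K`-vector spaces, where `K` is the
trivial right `U(L)`-module: `K ⊗_{U(L)} V` is the quotient of `K ⊗_K V = V` by the relations
`1 ⊗ a v = ε(a) ⊗ v`. -/
def trivialTensor :
    ModuleCat.{max u v} (UniversalEnvelopingAlgebra K L) ⥤ ModuleCat.{max u v} K where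
  obj V := ModuleCat.of K (V ⧸ relations K L V)
  map {V W} f := ModuleCat.ofHom
    (Submodule.mapQ (relations K L V) (relations K L W) (f.hom.restrictScalars K)
      (relations_le_comap f))
  map_id V := by
    ext x
    rfl
  map_comp f g := by
    ext x
    rfl

instance : (trivialTensor K L).Additive where
  map_add := by
    intro V W f g
    ext x
    obtain ⟨x, rfl⟩ := Submodule.Quotient.mk_surjective _ x
    rfl

/-- `Tor_n^{U(L)}(K, V)`, the `n`-th homology of the Lie algebra `L` with coefficients in the
`U(L)`-module `V`: the `n`-th left derived functor of `V ↦ K ⊗_{U(L)} V`. -/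
def homology (n : ℕ) (V : ModuleCat.{max u v} (UniversalEnvelopingAlgebra K L)) :
    ModuleCat.{max u v} K :=
  ((trivialTensor K L).leftDerived n).obj V

end LieHomology

/-- `L` is a free Lie algebra over `K`: it has a subset `X` such that the canonical morphism from
the free Lie algebra on `X` to `L` is an isomorphism. -/
def IsFreeLie (K : Type u) [Field K] (L : Type v) [LieRing L] [LieAlgebra K L] : Prop :=
  ∃ X : Set L, Function.Bijective (FreeLieAlgebra.lift K (fun x : X => (x : L)))

/-- `L` is finitely generated as a Lie algebra over `K`. -/
def IsFGLie (K : Type u) [Field K] (L : Type v) [LieRing L] [LieAlgebra K L] : Prop :=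
  ∃ S : Set L, S.Finite ∧ LieSubalgebra.lieSpan K L S = ⊤

/-- The lower central series with the indexing `γ_1(L) = L`, `γ_j(L) = [L, γ_{j-1}(L)]` for
`j ≥ 2` (and `γ_0(L) = L`). -/
def lieGamma (K : Type u) [Field K] (L : Type v) [LieRing L] [LieAlgebra K L] (j : ℕ) :
    LieIdeal K L :=
  LieModule.lowerCentralSeries K L L (j - 1)

end

/-! Fix `i ≠ j` and let `N` be the kernel of `L → F i`. The heart of the matter is that `N` still
maps onto `F j`. Given this, a) follows by correcting the `j`-th component of a preimage of the
first one. For b), a bracket of two elements of `L` vanishes wherever either factor does, so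
brackets of `k - 1` elements, each vanishing at a different index other than `j`, realise `γ_{k-1}(F
j)` inside `L` (`exists_mem_of_mem_lowerCentralSeries`).

Surjectivity of `N → F j` has two halves. The first shows that `H_1(N) = N/[N,N]` is
finite-dimensional (`finMod_ker_map`). Put `R = U(L)`, let `Ω` be its augmentation ideal, `B` the
kernel of `R → U(F i)` and `M = B/ΩB`. This is `H_1(N)`, as a right module over `U(F i)`, a free
algebra on a set `X` with at least two elements. Finiteness of `H_2(L)` makes the kernel of `⊕_X M →
M`, `(m_x) ↦ ∑ m_x x`, finite-dimensional (`finMod_families`); this kernel is `H_1(F i, M)`.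
Consider the `f` for which `M f` is finite-dimensional. They form a left ideal which, by this
finiteness, contains with `∑ c_x x` each coefficient `c_x`. A nonzero element of `L ∩ F i` commutes
with `N`, hence kills `M`, so the ideal is nonzero. A combinatorial argument on words
(`FreeMonoidAlgebra.one_mem_of_stripRight_mem`) then forces it to contain `1`.

In the second half (`exists_map_eq_of_finMod`) the image `I` of `N` in `F j` is a nonzero ideal with
`I/[I,I]` finite-dimensional. If `I` were proper, `U(F j / I)` would be an infinite-dimensional
domain, and `FreeMonoidAlgebra.injective_of_finMod_ker` would make `U(F j) → U(F j / I)` injective,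
which is absurd. That enveloping algebras are domains containing the Lie algebra comes from
Poincaré–Birkhoff–Witt, proved by the action on polynomials. -/

noncomputable section

/-! ### Poincaré–Birkhoff–Witt: the action of a Lie algebra on polynomials. -/

namespace PBW

open MvPolynomial

attribute [local instance 100] LieRing.ofAssociativeRing

variable {K : Type u} [Field K] {σ : Type v}

/-- The polynomials of total degree less than `n`. -/
def degLT (K : Type u) [Field K] (σ : Type v) (n : ℕ) : Submodule K (MvPolynomial σ K) :=
  Submodule.span K {p | ∃ m : σ →₀ ℕ, m.degree < n ∧ p = monomial m 1}

lemma monomial_mem_degLT {m : σ →₀ ℕ} {n : ℕ} (h : m.degree < n) :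
    monomial m (1 : K) ∈ degLT K σ n :=
  Submodule.subset_span ⟨m, h, rfl⟩

lemma degLT_mono {m n : ℕ} (h : m ≤ n) : degLT K σ m ≤ degLT K σ n := by
  refine Submodule.span_mono ?_
  rintro _ ⟨m, hm, rfl⟩
  exact ⟨m, hm.trans_le h, rfl⟩

lemma coeff_of_mem_degLT {n : ℕ} {p : MvPolynomial σ K} (hp : p ∈ degLT K σ n) {m : σ →₀ ℕ}
    (hm : n ≤ m.degree) : coeff m p = 0 := by
  induction hp using Submodule.span_induction with
  | mem x h =>
    classical
    obtain ⟨t, ht, rfl⟩ := h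
    rw [coeff_monomial, if_neg]
    rintro rfl
    omega
  | zero => simp
  | add x y _ _ hx hy => simp [hx, hy]
  | smul a x _ hx => simp [hx]

lemma X_mul_monomial (i : σ) (m : σ →₀ ℕ) :
    X i * monomial m (1 : K) = monomial (Finsupp.single i 1 + m) 1 := by
  rw [X, monomial_mul, one_mul]

lemma mul_mem_degLT_of_isHomogeneous {p q : MvPolynomial σ K} {n k : ℕ} (hp : p.IsHomogeneous n)
    (hq : q ∈ degLT K σ k) : p * q ∈ degLT K σ (k + n) := by
  rw [p.as_sum, Finset.sum_mul]
  refine Submodule.sum_mem _ fun m hm => ?_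
  have hmn : m.degree = n := by
    rw [Finsupp.degree_eq_weight_one]
    exact hp (mem_support_iff.1 hm)
  induction hq using Submodule.span_induction with
  | mem x h =>
    obtain ⟨t, ht, rfl⟩ := h
    rw [monomial_mul, mul_one]
    have : monomial (m + t) (coeff m p) = coeff m p • monomial (m + t) (1 : K) := by
      simp [smul_monomial]
    rw [this]
    refine Submodule.smul_mem _ _ (monomial_mem_degLT ?_)
    rw [map_add]
    omega
  | zero => simp
  | add x y _ _ hx hy => rw [mul_add]; exact add_mem hx hy
  | smul a x _ hx => rw [mul_smul_comm]; exact Submodule.smul_mem _ _ hx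

lemma basisMonomials_constr_apply {M : Type*} [AddCommGroup M] [Module K M]
    (f : (σ →₀ ℕ) → M) (m : σ →₀ ℕ) :
    (basisMonomials σ K).constr K f (monomial m 1) = f m := by
  have := (basisMonomials σ K).constr_basis K f m
  rwa [coe_basisMonomials] at this

section Action

variable {L : Type v} [LieRing L] [LieAlgebra K L] (b : Module.Basis σ K L)

lemma linearMap_ext_degLT {M : Type*} [AddCommGroup M] [Module K M] {n : ℕ}
    {f g : L →ₗ[K] MvPolynomial σ K →ₗ[K] M}
    (h : ∀ i m, m.degree < n → f (b i) (monomial m 1) = g (b i) (monomial m 1))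
    (x : L) {q : MvPolynomial σ K} (hq : q ∈ degLT K σ n) : f x q = g x q := by
  induction hq using Submodule.span_induction with
  | mem y hy =>
    obtain ⟨t, ht, rfl⟩ := hy
    exact LinearMap.congr_fun (b.ext (f₁ := f.flip (monomial t 1)) (f₂ := g.flip (monomial t 1))
      fun i => h i t ht) x
  | zero => simp
  | add y z _ _ hy hz => simp [hy, hz]
  | smul a y _ hy => simp [hy]

/-- The linear form in the variables corresponding to an element of the Lie algebra. -/
def linForm : L →ₗ[K] MvPolynomial σ K := b.constr K X

@[simp] lemma linForm_basis (i : σ) : linForm b (b i) = X i := by simp [linForm]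

lemma isHomogeneous_linForm (x : L) : (linForm b x).IsHomogeneous 1 := by
  rw [← mem_homogeneousSubmodule]
  have : LinearMap.range (linForm b) ≤ homogeneousSubmodule σ K 1 := by
    rw [linForm, Module.Basis.constr_range, Submodule.span_le]
    rintro _ ⟨i, rfl⟩
    exact isHomogeneous_X K i
  exact this ⟨x, rfl⟩

lemma sub_linForm_mem {n k : ℕ} {f : L →ₗ[K] MvPolynomial σ K →ₗ[K] MvPolynomial σ K}
    (h : ∀ i m, m.degree < n → f (b i) (monomial m 1) - X i * monomial m 1 ∈
      degLT K σ (m.degree + 1)) (x : L) {q : MvPolynomial σ K} (hq : q ∈ degLT K σ k)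
    (hk : k ≤ n) : f x q - linForm b x * q ∈ degLT K σ k := by
  have := linearMap_ext_degLT b (f := (f - (LinearMap.mul K _).comp (linForm b)).compr₂
    (degLT K σ k).mkQ) (g := 0) (n := k) (fun i m hm => by
      have := degLT_mono (K := K) (σ := σ) (Nat.succ_le_of_lt hm) (h i m (hm.trans_le hk))
      exact (Submodule.Quotient.mk_eq_zero _).2 (by simpa using this)) x hq
  have := (Submodule.Quotient.mk_eq_zero _).1 this
  simpa using this

lemma mem_degLT_of_sub_linForm {k : ℕ} {x : L} {p q : MvPolynomial σ K}
    (h : p - linForm b x * q ∈ degLT K σ k) (hq : q ∈ degLT K σ k) : p ∈ degLT K σ (k + 1) := by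
  rw [← sub_add_cancel p (linForm b x * q)]
  exact (degLT K σ (k + 1)).add_mem (degLT_mono k.le_succ h)
    (mul_mem_degLT_of_isHomogeneous (isHomogeneous_linForm b x) hq)

lemma degree_tsub_single {m : σ →₀ ℕ} {j : σ} (hj : j ∈ m.support) :
    (m - Finsupp.single j 1).degree + 1 = m.degree := by
  have h : Finsupp.single j 1 ≤ m := by
    rw [Finsupp.single_le_iff]
    exact Nat.one_le_iff_ne_zero.2 (Finsupp.mem_support_iff.1 hj)
  conv_rhs => rw [← tsub_add_cancel_of_le h, map_add, Finsupp.degree_single]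

variable [LinearOrder σ]

/-- Approximations of the action of a Lie algebra on the polynomials in an ordered basis; the
`n`-th one is correct on polynomials of degree at most `n`. -/
def stage : ℕ → L →ₗ[K] MvPolynomial σ K →ₗ[K] MvPolynomial σ K
  | 0 => b.constr K fun i => LinearMap.mulLeft K (X i)
  | n + 1 => b.constr K fun i => (basisMonomials σ K).constr K fun m =>
      if m.degree ≤ n then stage n (b i) (monomial m 1)
      else if h : ∃ j ∈ m.support, j < i then
        -- The value is forced by `x_i x_j t = x_j x_i t + [x_i, x_j] t`. Splitting `x_i t` into
        -- `X_i t` and a remainder of degree at most that of `t`, the ordered part of `x_j x_i t` is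
        -- `X_i X_j t`, and only the remainder needs the previous stage.
        let j := m.support.min' ⟨h.choose, h.choose_spec.1⟩
        let t := m - Finsupp.single j 1
        X i * monomial m 1
          + stage n (b j) (stage n (b i) (monomial t 1) - X i * monomial t 1)
          + stage n ⁅b i, b j⁆ (monomial t 1)
      else X i * monomial m 1

lemma stage_zero_apply (i : σ) (p : MvPolynomial σ K) : stage b 0 (b i) p = X i * p := by
  simp [stage]

lemma stage_succ_apply (n : ℕ) (i : σ) (m : σ →₀ ℕ) :
    stage b (n + 1) (b i) (monomial m 1) = if m.degree ≤ n then stage b n (b i) (monomial m 1)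
      else if h : ∃ j ∈ m.support, j < i then
        let j := m.support.min' ⟨h.choose, h.choose_spec.1⟩
        let t := m - Finsupp.single j 1
        X i * monomial m 1
          + stage b n (b j) (stage b n (b i) (monomial t 1) - X i * monomial t 1)
          + stage b n ⁅b i, b j⁆ (monomial t 1)
      else X i * monomial m 1 := by
  rw [stage, Module.Basis.constr_basis, basisMonomials_constr_apply]

lemma stage_succ_eq (n : ℕ) (x : L) {q : MvPolynomial σ K} (hq : q ∈ degLT K σ (n + 1)) :
    stage b (n + 1) x q = stage b n x q :=
  linearMap_ext_degLT b (fun i m hm => by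
    rw [stage_succ_apply, if_pos (Nat.lt_succ_iff.1 hm)]) x hq

lemma stage_eq_of_le {n n' : ℕ} (h : n ≤ n') (x : L) {q : MvPolynomial σ K}
    (hq : q ∈ degLT K σ (n + 1)) : stage b n' x q = stage b n x q := by
  induction n', h using Nat.le_induction with
  | base => rfl
  | succ k hk ih => rw [stage_succ_eq b k x (degLT_mono (by omega) hq), ih]

lemma stage_sub_mem_aux (n : ℕ) (i : σ) (m : σ →₀ ℕ) :
    stage b n (b i) (monomial m 1) - X i * monomial m 1 ∈ degLT K σ (m.degree + 1) := by
  induction n generalizing i m with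
  | zero => simp [stage_zero_apply]
  | succ n ih =>
    rw [stage_succ_apply]
    split_ifs with h1 h2
    · exact ih i m
    · dsimp only
      set j := m.support.min' ⟨h2.choose, h2.choose_spec.1⟩
      set t := m - Finsupp.single j 1
      have hdeg : t.degree + 1 = m.degree := degree_tsub_single (Finset.min'_mem _ _)
      have key : ∀ x : L, ∀ k, ∀ q ∈ degLT K σ k, stage b n x q ∈ degLT K σ (k + 1) :=
        fun x k q hq => mem_degLT_of_sub_linForm b
          (sub_linForm_mem b (fun i m _ => ih i m) x hq le_rfl) hq
      rw [add_assoc, add_sub_cancel_left]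
      refine add_mem (key _ _ _ ?_) ?_
      · rw [← hdeg]; exact ih i t
      · rw [← hdeg]
        exact key _ _ _ (monomial_mem_degLT t.degree.lt_succ_self)
    · simp

/-- The action of a Lie algebra on the polynomials in an ordered basis. -/
def act : L →ₗ[K] MvPolynomial σ K →ₗ[K] MvPolynomial σ K :=
  b.constr K fun i => (basisMonomials σ K).constr K fun m =>
    stage b m.degree (b i) (monomial m 1)

lemma act_apply (i : σ) (m : σ →₀ ℕ) :
    act b (b i) (monomial m 1) = stage b m.degree (b i) (monomial m 1) := by
  rw [act, Module.Basis.constr_basis, basisMonomials_constr_apply]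

lemma act_eq_stage {n : ℕ} (x : L) {q : MvPolynomial σ K} (hq : q ∈ degLT K σ (n + 1)) :
    act b x q = stage b n x q :=
  linearMap_ext_degLT b (fun i m hm => by
    rw [act_apply, stage_eq_of_le b (Nat.lt_succ_iff.1 hm) _
      (monomial_mem_degLT (Nat.lt_succ_self _))]) x hq

lemma act_sub_mem (x : L) {k : ℕ} {q : MvPolynomial σ K} (hq : q ∈ degLT K σ k) :
    act b x q - linForm b x * q ∈ degLT K σ k :=
  sub_linForm_mem b (n := k) (fun i m _ => by
    rw [act_apply]; exact stage_sub_mem_aux b _ i m) x hq le_rfl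

lemma act_mem (x : L) {k : ℕ} {q : MvPolynomial σ K} (hq : q ∈ degLT K σ k) :
    act b x q ∈ degLT K σ (k + 1) :=
  mem_degLT_of_sub_linForm b (act_sub_mem b x hq) hq

lemma act_of_le {i : σ} {m : σ →₀ ℕ} (h : ∀ j ∈ m.support, i ≤ j) :
    act b (b i) (monomial m 1) = X i * monomial m 1 := by
  have h' : ¬ ∃ j ∈ m.support, j < i := fun ⟨j, hj, hji⟩ => absurd (h j hj) (not_le.2 hji)
  rw [act_apply]
  rcases hm : m.degree with _ | n
  · exact stage_zero_apply b i _
  · rw [stage_succ_apply, if_neg (by omega), dif_neg h']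

/-- This is the recursive clause of `stage`, read back for the monomial `X j * t`, whose smallest
variable is `j`. -/
lemma act_of_lt {i j : σ} {t : σ →₀ ℕ} (hji : j < i) (h : ∀ l ∈ t.support, j ≤ l) :
    act b (b i) (act b (b j) (monomial t 1)) =
      act b (b j) (act b (b i) (monomial t 1)) + act b ⁅b i, b j⁆ (monomial t 1) := by
  set m := Finsupp.single j 1 + t with hm
  have hjm : j ∈ m.support := by simp [hm]
  have hmin : ∀ l ∈ m.support, j ≤ l := by
    intro l hl
    rcases Finset.mem_union.1 (Finsupp.support_add hl) with h1 | h1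
    · exact (Finset.mem_singleton.1 (Finsupp.support_single_subset h1)).ge
    · exact h l h1
  have hne : ∃ l ∈ m.support, l < i := ⟨j, hjm, hji⟩
  have hj : m.support.min' ⟨hne.choose, hne.choose_spec.1⟩ = j :=
    le_antisymm (Finset.min'_le _ _ hjm) (Finset.le_min' _ _ _ hmin)
  have hd : m.degree = t.degree + 1 := by simp [hm, add_comm]
  have ht : monomial t (1 : K) ∈ degLT K σ (t.degree + 1) :=
    monomial_mem_degLT (Nat.lt_succ_self _)
  have hXi : act b (b j) (X i * monomial t 1) = X j * (X i * monomial t 1) := by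
    rw [X_mul_monomial]
    refine act_of_le b fun l hl => ?_
    rcases Finset.mem_union.1 (Finsupp.support_add hl) with h1 | h1
    · rw [Finset.mem_singleton.1 (Finsupp.support_single_subset h1)]; exact hji.le
    · exact h l h1
  rw [act_of_le b h, X_mul_monomial, ← hm, act_apply, hd, stage_succ_apply, if_neg (by omega),
    dif_pos hne]
  dsimp only
  rw [hj, hm, add_tsub_cancel_left, ← act_eq_stage b _ ht, ← act_eq_stage b _ ht,
    ← act_eq_stage b, map_sub, hXi, ← X_mul_monomial]
  · ring
  · have := act_sub_mem b (b i) ht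
    rwa [linForm_basis] at this

/-- The defect of `act` from being an action of a Lie algebra. -/
def defect : L →ₗ[K] L →ₗ[K] MvPolynomial σ K →ₗ[K] MvPolynomial σ K :=
  LinearMap.mk₂ K (fun x y => act b x ∘ₗ act b y - act b y ∘ₗ act b x - act b ⁅x, y⁆)
    (fun x x' y => by ext; simp; ring)
    (fun c x y => by ext; simp; ring)
    (fun x y y' => by ext; simp; ring)
    (fun c x y => by ext; simp; ring)

lemma defect_apply (x y : L) (q : MvPolynomial σ K) :
    defect b x y q = act b x (act b y q) - act b y (act b x q) - act b ⁅x, y⁆ q := rfl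

lemma defect_swap (x y : L) (q : MvPolynomial σ K) : defect b x y q = - defect b y x q := by
  rw [defect_apply, defect_apply, ← lie_skew x y, map_neg, LinearMap.neg_apply]
  abel

/-- Induction on the degree. If `i` or `j` is at most every variable of `m`, the relation is
`act_of_lt` up to sign. Otherwise the smallest variable `a` of `m` lies below both; writing `m = X a
* t`, both operators are moved past `x_a`, and the terms cancel by the Jacobi identity and the
induction hypothesis. -/
lemma defect_basis_of_degree_lt (n : ℕ) : ∀ (i j : σ) (m : σ →₀ ℕ), m.degree < n →
    defect b (b i) (b j) (monomial m 1) = 0 := by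
  induction n with
  | zero => simp
  | succ n ih =>
    have ih' : ∀ (x y : L) (q : MvPolynomial σ K), q ∈ degLT K σ n → defect b x y q = 0 := by
      intro x y q hq
      induction hq using Submodule.span_induction with
      | mem z hz =>
        obtain ⟨t, ht, rfl⟩ := hz
        have := LinearMap.ext_basis b b (B := (defect b).compr₂ (LinearMap.applyₗ (monomial t 1)))
          (B' := 0) fun i j => by simpa using ih i j t ht
        simpa using LinearMap.congr_fun₂ this x y
      | zero => simp
      | add z w _ _ hz hw => rw [map_add, hz, hw, add_zero]
      | smul a z _ hz => rw [map_smul, hz, smul_zero]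
    have ih'' : ∀ (x y : L) (q : MvPolynomial σ K), q ∈ degLT K σ n →
        act b x (act b y q) = act b y (act b x q) + act b ⁅x, y⁆ q := by
      intro x y q hq
      have := ih' x y q hq
      rw [defect_apply, sub_sub, sub_eq_zero] at this
      exact this
    have key : ∀ (i j : σ) (m : σ →₀ ℕ), j < i → (∀ l ∈ m.support, j ≤ l) →
        defect b (b i) (b j) (monomial m 1) = 0 := by
      intro i j m hji h
      rw [defect_apply, act_of_lt b hji h]
      abel
    intro i j m hm
    by_cases h1 : ∀ l ∈ m.support, j ≤ l
    · rcases lt_trichotomy j i with h | h | h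
      · exact key i j m h h1
      · subst h; simp [defect_apply]
      · rw [defect_swap, key j i m h fun l hl => h.le.trans (h1 l hl), neg_zero]
    by_cases h2 : ∀ l ∈ m.support, i ≤ l
    · rcases lt_trichotomy i j with h | h | h
      · rw [defect_swap, key j i m h h2, neg_zero]
      · subst h; simp [defect_apply]
      · exact key i j m h fun l hl => h.le.trans (h2 l hl)
    push Not at h1 h2
    obtain ⟨l₁, hl₁, hlj⟩ := h1
    obtain ⟨l₂, hl₂, hli⟩ := h2
    set a := m.support.min' ⟨l₁, hl₁⟩ with ha
    have haj : a < j := (Finset.min'_le _ _ hl₁).trans_lt hlj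
    have hai : a < i := (Finset.min'_le _ _ hl₂).trans_lt hli
    set t := m - Finsupp.single a 1 with ht
    have hat : Finsupp.single a 1 ≤ m := by
      rw [Finsupp.single_le_iff]
      exact Nat.one_le_iff_ne_zero.2 (Finsupp.mem_support_iff.1 (Finset.min'_mem _ _))
    have hmt : m = Finsupp.single a 1 + t := (add_tsub_cancel_of_le hat).symm
    have hdeg : t.degree + 1 = m.degree := degree_tsub_single (Finset.min'_mem _ _)
    have hle : ∀ l ∈ t.support, a ≤ l := fun l hl =>
      Finset.min'_le _ _ (Finsupp.support_mono tsub_le_self hl)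
    have htn : monomial t (1 : K) ∈ degLT K σ n := monomial_mem_degLT (by omega)
    have hz : monomial m (1 : K) = act b (b a) (monomial t 1) := by
      rw [act_of_le b hle, X_mul_monomial, ← hmt]
    have step : ∀ i j : σ, a < i → a < j → act b (b i) (act b (b j) (monomial m 1)) =
        act b (b a) (act b (b i) (act b (b j) (monomial t 1)))
          + act b ⁅b i, b a⁆ (act b (b j) (monomial t 1))
          + act b ⁅b j, b a⁆ (act b (b i) (monomial t 1))
          + act b ⁅b i, ⁅b j, b a⁆⁆ (monomial t 1) := by
      intro i j hi hj
      have h1 : act b (b i) (act b (b a) (act b (b j) (monomial t 1))) =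
          act b (b a) (act b (b i) (act b (b j) (monomial t 1))) +
            act b ⁅b i, b a⁆ (act b (b j) (monomial t 1)) := by
        -- The full polynomial is too large for the induction hypothesis. Its leading monomial `X j
        -- * t` has no variable below `a`, so `act_of_lt` applies to it; only the remainder `w` is
        -- left to the induction.
        have e : act b (b j) (monomial t 1) = X j * monomial t 1 +
            (act b (b j) (monomial t 1) - X j * monomial t 1) := by ring
        have hw : act b (b j) (monomial t 1) - X j * monomial t 1 ∈ degLT K σ n := by
          have := act_sub_mem b (b j) htn
          rwa [linForm_basis] at this
        rw [e]
        generalize act b (b j) (monomial t 1) - X j * monomial t 1 = w at hw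
        have h3 : act b (b i) (act b (b a) (X j * monomial t 1)) =
            act b (b a) (act b (b i) (X j * monomial t 1)) +
              act b ⁅b i, b a⁆ (X j * monomial t 1) := by
          rw [X_mul_monomial]
          refine act_of_lt b hi fun l hl => ?_
          rcases Finset.mem_union.1 (Finsupp.support_add hl) with h1 | h1
          · rw [Finset.mem_singleton.1 (Finsupp.support_single_subset h1)]; exact hj.le
          · exact hle l h1
        simp only [map_add]
        rw [h3, ih'' (b i) (b a) w hw]
        abel
      rw [hz, act_of_lt b hj hle, map_add, h1, ih'' (b i) ⁅b j, b a⁆ _ htn]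
      abel
    have hjac : ⁅b i, ⁅b j, b a⁆⁆ - ⁅b j, ⁅b i, b a⁆⁆ = ⁅⁅b i, b j⁆, b a⁆ := by
      rw [lie_lie]
    have e1 : act b (b a) (act b (b i) (act b (b j) (monomial t 1))) =
        act b (b a) (act b (b j) (act b (b i) (monomial t 1)))
          + act b (b a) (act b ⁅b i, b j⁆ (monomial t 1)) := by
      rw [← map_add, ih'' (b i) (b j) _ htn]
    rw [defect_apply, step i j hai haj, step j i haj hai, e1, hz,
      ih'' ⁅b i, b j⁆ (b a) _ htn, ← hjac, map_sub, LinearMap.sub_apply]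
    abel

lemma act_lie (x y : L) (q : MvPolynomial σ K) :
    act b ⁅x, y⁆ q = act b x (act b y q) - act b y (act b x q) := by
  have h0 : defect b = 0 := LinearMap.ext_basis b b fun i j => by
    refine (basisMonomials σ K).ext fun m => ?_
    rw [coe_basisMonomials]
    exact defect_basis_of_degree_lt b _ i j m (Nat.lt_succ_self _)
  have := defect_apply b x y q
  rw [h0] at this
  simp only [LinearMap.zero_apply] at this
  exact (sub_eq_zero.1 this.symm).symm

/-- The polynomials in an ordered basis of a Lie algebra, as a representation. -/
def rep : L →ₗ⁅K⁆ Module.End K (MvPolynomial σ K) :=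
  { act b with
    map_lie' := by
      intro x y
      exact LinearMap.ext (act_lie b x y) }

end Action

end PBW

/-! ### Filtration of the enveloping algebra and leading symbols. -/

namespace PBW

open MvPolynomial

attribute [local instance 100] LieRing.ofAssociativeRing

/-- By the universal property, `ι` lifts to a homomorphism into `S`, which followed by the inclusion
is the identity. It serves as an induction principle for enveloping algebras. -/
lemma subalgebra_eq_top {K : Type u} [Field K] {L : Type v} [LieRing L] [LieAlgebra K L]
    (S : Subalgebra K (UniversalEnvelopingAlgebra K L))
    (h : ∀ x : L, UniversalEnvelopingAlgebra.ι K x ∈ S) : S = ⊤ := by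
  let f : L →ₗ⁅K⁆ S :=
    { toFun := fun x => ⟨UniversalEnvelopingAlgebra.ι K x, h x⟩
      map_add' := fun x y => Subtype.ext (by simp only [map_add]; rfl)
      map_smul' := fun c x => Subtype.ext (by simp only [map_smul]; rfl)
      map_lie' := fun {x y} => Subtype.ext (LieHom.map_lie (UniversalEnvelopingAlgebra.ι K) x y) }
  have : S.val.comp (UniversalEnvelopingAlgebra.lift K f) = AlgHom.id K _ := by
    apply UniversalEnvelopingAlgebra.hom_ext
    ext x
    change (UniversalEnvelopingAlgebra.lift K f (UniversalEnvelopingAlgebra.ι K x)).1 = _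
    rw [UniversalEnvelopingAlgebra.lift_ι_apply]
    rfl
  rw [eq_top_iff]
  intro u _
  have hu := AlgHom.congr_fun this u
  rw [AlgHom.id_apply] at hu
  rw [← hu]
  exact (UniversalEnvelopingAlgebra.lift K f u).2

variable {K : Type u} [Field K] {σ : Type v}

/-- The space of homogeneous polynomials of degree `n`. -/
def homog (K : Type u) [Field K] (σ : Type v) (n : ℕ) : Submodule K (MvPolynomial σ K) :=
  Submodule.span K {p | ∃ m : σ →₀ ℕ, m.degree = n ∧ p = monomial m 1}

lemma isHomogeneous_of_mem_homog {n : ℕ} {p : MvPolynomial σ K} (hp : p ∈ homog K σ n) :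
    p.IsHomogeneous n := by
  rw [← mem_homogeneousSubmodule]
  refine (Submodule.span_le (p := homogeneousSubmodule σ K n)).2 ?_ hp
  rintro _ ⟨m, hm, rfl⟩
  exact isHomogeneous_monomial 1 hm

lemma card_toMultiset (m : σ →₀ ℕ) : (Finsupp.toMultiset m).card = m.degree :=
  Finsupp.card_toMultiset m

lemma prod_map_X_toMultiset (m : σ →₀ ℕ) :
    ((Finsupp.toMultiset m).map (X : σ → MvPolynomial σ K)).prod = monomial m 1 := by
  induction m using Finsupp.induction_linear with
  | zero => simp
  | add f g hf hg => rw [map_add, Multiset.map_add, Multiset.prod_add, hf, hg, monomial_mul, one_mul]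
  | single i n =>
    rw [Finsupp.toMultiset_single, Multiset.map_nsmul, Multiset.map_singleton,
      Multiset.prod_nsmul, Multiset.prod_singleton, X_pow_eq_monomial]

variable {L : Type v} [LieRing L] [LieAlgebra K L]

/-- The span of the products of fewer than `n` elements of the Lie algebra. -/
def filt (K : Type u) [Field K] (L : Type v) [LieRing L] [LieAlgebra K L] (n : ℕ) :
    Submodule K (UniversalEnvelopingAlgebra K L) :=
  Submodule.span K
    {u | ∃ l : List L, l.length < n ∧ u = (l.map (UniversalEnvelopingAlgebra.ι K)).prod}

lemma prod_mem_filt {l : List L} {n : ℕ} (h : l.length < n) :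
    (l.map (UniversalEnvelopingAlgebra.ι K)).prod ∈ filt K L n :=
  Submodule.subset_span ⟨l, h, rfl⟩

lemma filt_mono {m n : ℕ} (h : m ≤ n) : filt K L m ≤ filt K L n := by
  refine Submodule.span_mono ?_
  rintro _ ⟨m, hm, rfl⟩
  exact ⟨m, hm.trans_le h, rfl⟩

lemma filt_zero : filt K L 0 = ⊥ := by
  simp [filt]

lemma mul_mem_filt {m n : ℕ} {u v : UniversalEnvelopingAlgebra K L} (hu : u ∈ filt K L (m + 1))
    (hv : v ∈ filt K L n) : u * v ∈ filt K L (m + n) := by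
  have : u * v ∈ filt K L (m + 1) * filt K L n := Submodule.mul_mem_mul hu hv
  rw [filt, filt, Submodule.span_mul_span] at this
  refine (Submodule.span_le (p := filt K L (m + n))).2 ?_ this
  rintro _ ⟨_, ⟨l, hl, rfl⟩, _, ⟨l', hl', rfl⟩, rfl⟩
  dsimp only
  rw [← List.prod_append, ← List.map_append]
  exact prod_mem_filt (by rw [List.length_append]; omega)

lemma ι_mem_filt (x : L) : UniversalEnvelopingAlgebra.ι K x ∈ filt K L 2 := by
  simpa using prod_mem_filt (K := K) (l := [x]) (n := 2) (by simp)

lemma exists_mem_filt (u : UniversalEnvelopingAlgebra K L) : ∃ n, u ∈ filt K L n := by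
  have one_mem : (1 : UniversalEnvelopingAlgebra K L) ∈ filt K L 1 := by
    simpa using prod_mem_filt (K := K) (L := L) (l := []) (n := 1) (by simp)
  let S : Subalgebra K (UniversalEnvelopingAlgebra K L) :=
    { carrier := {u | ∃ n, u ∈ filt K L n}
      mul_mem' := by
        rintro u v ⟨m, hu⟩ ⟨n, hv⟩
        exact ⟨m + n, mul_mem_filt (filt_mono m.le_succ hu) hv⟩
      add_mem' := by
        rintro u v ⟨m, hu⟩ ⟨n, hv⟩
        exact ⟨max m n, add_mem (filt_mono (le_max_left _ _) hu) (filt_mono (le_max_right _ _) hv)⟩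
      algebraMap_mem' := fun c => ⟨1, by
        rw [Algebra.algebraMap_eq_smul_one]
        exact Submodule.smul_mem _ _ one_mem⟩ }
  have : S = ⊤ := subalgebra_eq_top S fun x => ⟨2, ι_mem_filt x⟩
  have hu : u ∈ S := this ▸ Algebra.mem_top
  exact hu

lemma ι_mul_ι (x y : L) : UniversalEnvelopingAlgebra.ι K x * UniversalEnvelopingAlgebra.ι K y =
    UniversalEnvelopingAlgebra.ι K y * UniversalEnvelopingAlgebra.ι K x +
      UniversalEnvelopingAlgebra.ι K ⁅x, y⁆ := by
  rw [LieHom.map_lie, LieRing.of_associative_ring_bracket]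
  abel

/-- Exchanging two neighbours costs a product in which they are replaced by their bracket, which is
shorter by one. -/
lemma prod_sub_prod_mem_filt {l l' : List L} (h : l.Perm l') :
    (l.map (UniversalEnvelopingAlgebra.ι K)).prod - (l'.map (UniversalEnvelopingAlgebra.ι K)).prod
      ∈ filt K L l.length := by
  induction h with
  | nil => simp
  | cons x h ih =>
    rw [List.map_cons, List.map_cons, List.prod_cons, List.prod_cons, ← mul_sub, List.length_cons,
      add_comm]
    exact mul_mem_filt (ι_mem_filt x) ih
  | swap x y l =>
    simp only [List.map_cons, List.prod_cons]
    rw [← mul_assoc, ← mul_assoc, ← sub_mul, ι_mul_ι, add_sub_cancel_left]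
    have := prod_mem_filt (K := K) (l := ⁅y, x⁆ :: l) (n := (y :: x :: l).length) (by simp)
    simpa using this
  | trans h₁ h₂ ih₁ ih₂ =>
    rw [← sub_add_sub_cancel]
    refine add_mem ih₁ ?_
    rw [h₁.length_eq]
    exact ih₂

/-- The linear map sending each monomial to a product of the corresponding basis elements. -/
def expand (b : Module.Basis σ K L) : MvPolynomial σ K →ₗ[K] UniversalEnvelopingAlgebra K L :=
  (basisMonomials σ K).constr K fun m =>
    (((Finsupp.toMultiset m).toList.map b).map (UniversalEnvelopingAlgebra.ι K)).prod

lemma expand_monomial (b : Module.Basis σ K L) (m : σ →₀ ℕ) : expand b (monomial m 1) =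
    (((Finsupp.toMultiset m).toList.map b).map (UniversalEnvelopingAlgebra.ι K)).prod :=
  basisMonomials_constr_apply _ _

lemma ι_mul_expand_mem (b : Module.Basis σ K L) (x : L) {n : ℕ} {p : MvPolynomial σ K}
    (hp : p ∈ homog K σ n) : UniversalEnvelopingAlgebra.ι K x * expand b p ∈
      (homog K σ (n + 1)).map (expand b) ⊔ filt K L (n + 1) := by
  induction hp using Submodule.span_induction with
  | mem q hq =>
    obtain ⟨m, rfl, rfl⟩ := hq
    have hx : x ∈ Submodule.span K (Set.range b) := b.mem_span x
    induction hx using Submodule.span_induction with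
    | mem y hy =>
      obtain ⟨i, rfl⟩ := hy
      have hperm : ((i :: (Finsupp.toMultiset m).toList).map b).Perm
          ((Finsupp.toMultiset (Finsupp.single i 1 + m)).toList.map b) := by
        refine List.Perm.map _ ?_
        rw [← Multiset.coe_eq_coe, ← Multiset.cons_coe, Multiset.coe_toList, Multiset.coe_toList,
          map_add, Finsupp.toMultiset_single, one_smul, Multiset.singleton_add]
      have h := prod_sub_prod_mem_filt (K := K) hperm
      rw [← expand_monomial, List.map_cons, List.map_cons, List.prod_cons, ← expand_monomial,
        List.length_cons, List.length_map, Multiset.length_toList, card_toMultiset] at h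
      have hmem : expand b (monomial (Finsupp.single i 1 + m) 1) ∈
          (homog K σ (m.degree + 1)).map (expand b) :=
        Submodule.mem_map_of_mem (Submodule.subset_span
          ⟨_, by rw [map_add, Finsupp.degree_single, add_comm], rfl⟩)
      have := Submodule.add_mem_sup hmem h
      rwa [add_sub_cancel] at this
    | zero => simp
    | add y z _ _ hy hz => rw [map_add, add_mul]; exact add_mem hy hz
    | smul a y _ hy => rw [map_smul, smul_mul_assoc]; exact Submodule.smul_mem _ _ hy
  | zero => simp
  | add y z _ _ hy hz => rw [map_add, mul_add]; exact add_mem hy hz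
  | smul a y _ hy => rw [map_smul, mul_smul_comm]; exact Submodule.smul_mem _ _ hy

lemma filt_succ_le (b : Module.Basis σ K L) (n : ℕ) :
    filt K L (n + 1) ≤ (homog K σ n).map (expand b) ⊔ filt K L n := by
  refine Submodule.span_le.2 ?_
  rintro _ ⟨l, hl, rfl⟩
  rcases (Nat.lt_succ_iff.1 hl).lt_or_eq with h | rfl
  · exact Submodule.mem_sup_right (prod_mem_filt h)
  clear hl
  induction l with
  | nil =>
    refine Submodule.mem_sup_left ⟨monomial 0 1, Submodule.subset_span ⟨0, by simp, rfl⟩, ?_⟩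
    rw [expand_monomial]
    simp
  | cons x l ih =>
    obtain ⟨_, ⟨p, hp, rfl⟩, u, hu, h⟩ := Submodule.mem_sup.1 ih
    rw [SetLike.mem_coe, List.map_cons, List.prod_cons, ← h, mul_add, List.length_cons]
    refine add_mem (ι_mul_expand_mem b x hp) (Submodule.mem_sup_right ?_)
    rw [add_comm]
    exact mul_mem_filt (ι_mem_filt x) hu

lemma isHomogeneous_prod_linForm (b : Module.Basis σ K L) (l : List L) :
    ((l.map (linForm b)).prod).IsHomogeneous l.length := by
  induction l with
  | nil => simpa using isHomogeneous_one σ K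
  | cons x l ih =>
    rw [List.map_cons, List.prod_cons, List.length_cons, add_comm]
    exact (isHomogeneous_linForm b x).mul ih

variable [LinearOrder σ] (b : Module.Basis σ K L)

/-- The action of the universal enveloping algebra on the polynomials in an ordered basis. -/
def toEnd : UniversalEnvelopingAlgebra K L →ₐ[K] Module.End K (MvPolynomial σ K) :=
  UniversalEnvelopingAlgebra.lift K (rep b)

lemma toEnd_ι (x : L) (q : MvPolynomial σ K) :
    toEnd b (UniversalEnvelopingAlgebra.ι K x) q = act b x q := by
  rw [toEnd, UniversalEnvelopingAlgebra.lift_ι_apply]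
  rfl

/-- The element `u` acts, up to terms of lower degree, as multiplication by a polynomial `p` of
degree `n`. -/
def HasSymbol (u : UniversalEnvelopingAlgebra K L) (n : ℕ) (p : MvPolynomial σ K) : Prop :=
  ∀ k, ∀ q ∈ degLT K σ (k + 1), toEnd b u q - p * q ∈ degLT K σ (k + n)

variable {b} in
lemma HasSymbol.add {u v : UniversalEnvelopingAlgebra K L} {n : ℕ} {p q : MvPolynomial σ K}
    (hu : HasSymbol b u n p) (hv : HasSymbol b v n q) : HasSymbol b (u + v) n (p + q) := by
  intro k r hr
  have := add_mem (hu k r hr) (hv k r hr)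
  rwa [sub_add_sub_comm, ← add_mul, ← LinearMap.add_apply, ← map_add] at this

variable {b} in
lemma HasSymbol.smul {u : UniversalEnvelopingAlgebra K L} {n : ℕ} {p : MvPolynomial σ K}
    (hu : HasSymbol b u n p) (c : K) : HasSymbol b (c • u) n (c • p) := by
  intro k r hr
  have := Submodule.smul_mem _ c (hu k r hr)
  rwa [smul_sub, ← smul_mul_assoc, ← LinearMap.smul_apply, ← map_smul] at this

lemma hasSymbol_zero (n : ℕ) : HasSymbol b 0 n 0 := by
  intro k q _
  simp

lemma hasSymbol_prod (l : List L) : HasSymbol b (l.map (UniversalEnvelopingAlgebra.ι K)).prod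
    l.length (l.map (linForm b)).prod := by
  induction l with
  | nil => intro k q _; simp
  | cons x l ih =>
    intro k q hq
    set u := (l.map (UniversalEnvelopingAlgebra.ι K)).prod
    set p := (l.map (linForm b)).prod with hp
    have h1 := act_mem b x (ih k q hq)
    have hpq : p * q ∈ degLT K σ (k + 1 + l.length) :=
      mul_mem_degLT_of_isHomogeneous (isHomogeneous_prod_linForm b l) hq
    have h2 := act_sub_mem b x hpq
    rw [add_right_comm] at h2
    have h3 := add_mem h1 h2
    rw [map_sub, sub_add_sub_cancel] at h3
    rw [List.map_cons, List.prod_cons, map_mul, Module.End.mul_apply, toEnd_ι, List.map_cons,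
      List.prod_cons, mul_assoc, List.length_cons]
    exact h3

lemma hasSymbol_of_mem_filt {n : ℕ} {u : UniversalEnvelopingAlgebra K L} (hu : u ∈ filt K L n) :
    HasSymbol b u n 0 := by
  induction hu using Submodule.span_induction with
  | mem x h =>
    obtain ⟨l, hl, rfl⟩ := h
    intro k q hq
    have h1 := degLT_mono (by omega : k + l.length ≤ k + n) (hasSymbol_prod b l k q hq)
    have h2 := degLT_mono (by omega : k + 1 + l.length ≤ k + n)
      (mul_mem_degLT_of_isHomogeneous (isHomogeneous_prod_linForm b l) hq)
    have := add_mem h1 h2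
    rwa [sub_add_cancel, ← sub_zero (toEnd b _ q), ← zero_mul q] at this
  | zero => exact hasSymbol_zero b n
  | add u v _ _ hu hv => simpa using hu.add hv
  | smul a u _ hu => simpa using hu.smul a

lemma hasSymbol_expand {n : ℕ} {p : MvPolynomial σ K} (hp : p ∈ homog K σ n) :
    HasSymbol b (expand b p) n p := by
  induction hp using Submodule.span_induction with
  | mem x h =>
    obtain ⟨m, rfl, rfl⟩ := h
    have := hasSymbol_prod b ((Finsupp.toMultiset m).toList.map b)
    rw [← expand_monomial, List.map_map] at this
    have h1 : (linForm b : L → MvPolynomial σ K) ∘ b = X := by ext1 i; simp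
    have h2 : ((Finsupp.toMultiset m).toList.map (X : σ → MvPolynomial σ K)).prod = monomial m 1 := by
      rw [← prod_map_X_toMultiset, ← Multiset.prod_coe, ← Multiset.map_coe, Multiset.coe_toList]
    rwa [h1, h2, List.length_map, Multiset.length_toList, card_toMultiset] at this
  | zero => rw [map_zero]; exact hasSymbol_zero b n
  | add u v _ _ hu hv => rw [map_add]; exact hu.add hv
  | smul a u _ hu => rw [map_smul]; exact hu.smul a

/-- In the smallest filtration step containing `u`, the element is an ordered expansion of a
homogeneous `p` plus shorter products. Minimality gives `p ≠ 0`, and the shorter products do not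
affect the symbol. -/
lemma exists_hasSymbol {u : UniversalEnvelopingAlgebra K L} (hu : u ≠ 0) :
    ∃ n p, p.IsHomogeneous n ∧ p ≠ 0 ∧ HasSymbol b u n p := by
  classical
  have hex := exists_mem_filt u
  rcases hn : Nat.find hex with _ | n
  · have := Nat.find_spec hex
    rw [hn, filt_zero] at this
    exact absurd this hu
  · have := Nat.find_spec hex
    rw [hn] at this
    obtain ⟨_, ⟨p, hp, rfl⟩, v, hv, h⟩ := Submodule.mem_sup.1 (filt_succ_le b n this)
    refine ⟨n, p, isHomogeneous_of_mem_homog hp, ?_, ?_⟩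
    · rintro rfl
      rw [map_zero, zero_add] at h
      exact Nat.find_min hex (by omega : n < Nat.find hex) (h ▸ hv)
    · have := (hasSymbol_expand b hp).add (hasSymbol_of_mem_filt b hv)
      rwa [h, add_zero] at this

end PBW

/-! ### Consequences of Poincaré–Birkhoff–Witt. -/

section
variable (K : Type u) [Field K] (L : Type v) [LieRing L] [LieAlgebra K L]

open PBW MvPolynomial

/-- The universal enveloping algebra of a Lie algebra over a field has no zero divisors. -/
instance UniversalEnvelopingAlgebra.instNoZeroDivisors :
    NoZeroDivisors (UniversalEnvelopingAlgebra K L) where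
  eq_zero_or_eq_zero_of_mul_eq_zero {u v} huv := by
    let b := Module.Basis.ofVectorSpace K L
    let _ : LinearOrder (Module.Basis.ofVectorSpaceIndex K L) :=
      IsWellOrder.linearOrder WellOrderingRel
    by_contra! h
    obtain ⟨n, p, hp, hp0, hu⟩ := exists_hasSymbol b h.1
    obtain ⟨n', p', hp', hp0', hv⟩ := exists_hasSymbol b h.2
    have one_mem : (1 : MvPolynomial _ K) ∈ degLT K (Module.Basis.ofVectorSpaceIndex K L) (0 + 1) :=
      monomial_mem_degLT (m := 0) (by simp)
    -- Applied to `1`, first `v` and then `u` produce `p * p'` up to terms of degree below `n + n'`.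
    -- Since `u * v = 0`, the nonzero homogeneous polynomial `p * p'` would itself have degree below
    -- `n + n'`.
    have h1 := hv 0 1 one_mem
    have h2 := mul_mem_degLT_of_isHomogeneous hp' one_mem
    have h3 := add_mem (degLT_mono (by omega : 0 + n' ≤ 0 + 1 + n') h1) h2
    rw [sub_add_cancel] at h3
    have h4 := hu n' _ (by rwa [zero_add, add_comm] at h3)
    have h5 := mul_mem_degLT_of_isHomogeneous hp h1
    rw [zero_add] at h5
    have h6 := add_mem h4 h5
    rw [← Module.End.mul_apply, ← map_mul, huv, map_zero, mul_sub, sub_add_sub_cancel, mul_one,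
      LinearMap.zero_apply, zero_sub, neg_mem_iff] at h6
    obtain ⟨m, hm⟩ := MvPolynomial.ne_zero_iff.1 (mul_ne_zero hp0 hp0')
    refine hm (coeff_of_mem_degLT h6 ?_)
    have := (hp.mul hp') hm
    rw [Finsupp.degree_eq_weight_one]
    exact (add_comm _ _).trans_le this.ge

/-- A Lie algebra over a field embeds into its universal enveloping algebra. -/
lemma UniversalEnvelopingAlgebra.ι_injective :
    Function.Injective (UniversalEnvelopingAlgebra.ι K : L → UniversalEnvelopingAlgebra K L) := by
  let b := Module.Basis.ofVectorSpace K L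
  let _ : LinearOrder (Module.Basis.ofVectorSpaceIndex K L) :=
    IsWellOrder.linearOrder WellOrderingRel
  have h1 : ∀ x : L, act b x 1 = linForm b x := fun x =>
    LinearMap.congr_fun (b.ext (f₁ := (act b).flip 1) (f₂ := linForm b) fun i => by
      have := act_of_le b (i := i) (m := 0) (by simp)
      simpa using this) x
  rw [injective_iff_map_eq_zero]
  intro x hx
  have h2 : linForm b x = 0 := by rw [← h1, ← toEnd_ι, hx, map_zero, LinearMap.zero_apply]
  rw [linForm, Module.Basis.constr_apply] at h2
  have := linearIndependent_iff.1 (linearIndependent_X _ K) (b.repr x) h2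
  simpa using this

/-- The universal enveloping algebra of a nonzero Lie algebra is infinite-dimensional. -/
lemma UniversalEnvelopingAlgebra.not_finite [Nontrivial L] :
    ¬ Module.Finite K (UniversalEnvelopingAlgebra K L) := by
  intro _
  obtain ⟨x, hx⟩ := exists_ne (0 : L)
  set y := UniversalEnvelopingAlgebra.ι K x with hy
  have hy0 : y ≠ 0 := fun h => hx (UniversalEnvelopingAlgebra.ι_injective K L (by rw [← hy, h, map_zero]))
  -- In finite dimension, injectivity of left multiplication by `y` would give `y` a right inverse,
  -- but the augmentation kills `y`.
  have hinj : Function.Injective (LinearMap.mulLeft K y) := by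
    rw [injective_iff_map_eq_zero]
    intro u hu
    exact (mul_eq_zero.1 hu).resolve_left hy0
  obtain ⟨u, hu⟩ := (LinearMap.injective_iff_surjective.1 hinj) 1
  have := congrArg (LieHomology.augmentation K L) hu
  rw [LinearMap.mulLeft_apply, map_mul, map_one, hy, LieHomology.augmentation,
    UniversalEnvelopingAlgebra.lift_ι_apply] at this
  simp at this

end

/-! ### Finite-dimensionality modulo a subspace. -/

/-- The image of the subspace `S` in the quotient by `D` is finite-dimensional. -/
def FinMod {K V : Type*} [Field K] [AddCommGroup V] [Module K V] (S D : Submodule K V) : Prop :=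
  FiniteDimensional K (S.map D.mkQ)

namespace FinMod

variable {K V V' : Type*} [Field K] [AddCommGroup V] [Module K V] [AddCommGroup V'] [Module K V']

lemma mono {S S' D D' : Submodule K V} (h : FinMod S' D) (hS : S ≤ S' ⊔ D') (hD : D ≤ D') :
    FinMod S D' := by
  have : FiniteDimensional K (S'.map D.mkQ) := h
  have h1 : S.map D'.mkQ ≤ (S'.map D.mkQ).map (D.mapQ D' LinearMap.id hD) := by
    rintro _ ⟨s, hs, rfl⟩
    obtain ⟨s', hs', d, hd, rfl⟩ := Submodule.mem_sup.1 (hS hs)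
    refine ⟨D.mkQ s', ⟨s', hs', rfl⟩, ?_⟩
    rw [map_add, (Submodule.Quotient.mk_eq_zero D' (x := d)).2 hd |> (show D'.mkQ d = 0 from ·),
      add_zero]
    rfl
  exact Submodule.finiteDimensional_of_le h1

lemma map {S D : Submodule K V} (h : FinMod S D) (f : V →ₗ[K] V') {D' : Submodule K V'}
    (hD : D.map f ≤ D') : FinMod (S.map f) D' := by
  have : FiniteDimensional K (S.map D.mkQ) := h
  have h1 : (S.map f).map D'.mkQ ≤ (S.map D.mkQ).map (D.mapQ D' f (Submodule.map_le_iff_le_comap.1 hD)) := by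
    rintro _ ⟨_, ⟨s, hs, rfl⟩, rfl⟩
    exact ⟨D.mkQ s, ⟨s, hs, rfl⟩, rfl⟩
  exact Submodule.finiteDimensional_of_le h1

lemma comap {S D : Submodule K V} {S' D' : Submodule K V'} (h : FinMod S' D') (f : V →ₗ[K] V')
    (hS : ∀ s ∈ S, f s ∈ S') (hD : ∀ s ∈ S, f s ∈ D' → s ∈ D) : FinMod S D := by
  have : FiniteDimensional K (S'.map D'.mkQ) := h
  let g : S →ₗ[K] V' ⧸ D' := D'.mkQ ∘ₗ f ∘ₗ S.subtype
  let k : S →ₗ[K] V ⧸ D := D.mkQ ∘ₗ S.subtype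
  have hg : LinearMap.range g ≤ S'.map D'.mkQ := by
    rintro _ ⟨s, rfl⟩
    exact ⟨f s, hS s s.2, rfl⟩
  have : FiniteDimensional K (LinearMap.range g) := Submodule.finiteDimensional_of_le hg
  have : FiniteDimensional K (S ⧸ LinearMap.ker g) := g.quotKerEquivRange.symm.finiteDimensional
  have hk : LinearMap.ker g ≤ LinearMap.ker k := fun s hs =>
    (Submodule.Quotient.mk_eq_zero D).2 (hD s s.2 ((Submodule.Quotient.mk_eq_zero D').1 hs))
  have h1 : S.map D.mkQ ≤ LinearMap.range ((LinearMap.ker g).liftQ k hk) := by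
    rintro _ ⟨s, hs, rfl⟩
    exact ⟨(LinearMap.ker g).mkQ ⟨s, hs⟩, rfl⟩
  exact Submodule.finiteDimensional_of_le h1

end FinMod

/-! ### Comparison of beginnings of projective resolutions. -/

section Comparison

variable {K R : Type*} [Field K] [Ring R] [Algebra K R]

/-- The `K`-span of all `a • z - ε a • z` with `z ∈ Z`. -/
def augRel (ε : R →ₐ[K] K) {M : Type*} [AddCommGroup M] [Module R M] [Module K M]
    (Z : Submodule R M) : Submodule K M :=
  Submodule.span K {y | ∃ a : R, ∃ z ∈ Z, y = a • z - ε a • z}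

variable {ε : R →ₐ[K] K} {M N : Type*} [AddCommGroup M] [Module R M] [Module K M]
  [AddCommGroup N] [Module R N] [Module K N]

lemma smul_mem_augRel {a : R} (ha : ε a = 0) {Z : Submodule R M} {z : M} (hz : z ∈ Z) :
    a • z ∈ augRel ε Z :=
  Submodule.subset_span ⟨a, z, hz, by rw [ha, zero_smul, sub_zero]⟩

variable [IsScalarTower K R M] [IsScalarTower K R N]

lemma augRel_le {Z : Submodule R M} : augRel ε Z ≤ Z.restrictScalars K := by
  refine Submodule.span_le.2 ?_
  rintro _ ⟨a, z, hz, rfl⟩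
  exact Z.sub_mem (Z.smul_mem a hz) ((Z.restrictScalars K).smul_mem (ε a) hz)

lemma map_mem_augRel (f : M →ₗ[R] N) {Z : Submodule R M} {Z' : Submodule R N}
    (h : ∀ z ∈ Z, f z ∈ Z') {z : M} (hz : z ∈ augRel ε Z) : f z ∈ augRel ε Z' := by
  have : augRel ε Z ≤ (augRel ε Z').comap (f.restrictScalars K) := by
    refine Submodule.span_le.2 ?_
    rintro _ ⟨a, z, hz, rfl⟩
    refine Submodule.subset_span ⟨a, f z, h z hz, ?_⟩
    simp
  exact this hz

lemma exists_lift_of_range_eq_ker {A B C D : Type*} [AddCommGroup A] [Module R A]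
    [Module.Projective R A] [AddCommGroup B] [Module R B] [AddCommGroup C] [Module R C]
    [AddCommGroup D] [Module R D] {g : C →ₗ[R] B} {t : B →ₗ[R] D}
    (hg : LinearMap.range g = LinearMap.ker t) (f : A →ₗ[R] B) (hf : ∀ x, t (f x) = 0) :
    ∃ k : A →ₗ[R] C, ∀ x, g (k x) = f x := by
  obtain ⟨k, hk⟩ := Module.projective_lifting_property g.rangeRestrict
    (f.codRestrict (LinearMap.range g) fun x => by rw [hg]; exact hf x) g.surjective_rangeRestrict
  exact ⟨k, fun x => congrArg Subtype.val (LinearMap.congr_fun hk x)⟩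

/-- The second homology of a module, computed from the start of a projective resolution, does not
depend on the resolution; here this is shown for its finiteness. -/
lemma finMod_cycles_of_projective {T P₀ P₁ Q₀ Q₁ : Type*} [AddCommGroup T] [Module R T]
    [AddCommGroup P₀] [Module R P₀] [Module.Projective R P₀]
    [AddCommGroup P₁] [Module R P₁] [Module K P₁] [IsScalarTower K R P₁] [Module.Projective R P₁]
    [AddCommGroup Q₀] [Module R Q₀] [Module.Projective R Q₀]
    [AddCommGroup Q₁] [Module R Q₁] [Module K Q₁] [IsScalarTower K R Q₁] [Module.Projective R Q₁]
    (p : P₀ →ₗ[R] T) (d : P₁ →ₗ[R] P₀) (q : Q₀ →ₗ[R] T) (e : Q₁ →ₗ[R] Q₀)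
    (hp : Function.Surjective p) (hq : Function.Surjective q)
    (hd : LinearMap.range d = LinearMap.ker p) (he : LinearMap.range e = LinearMap.ker q)
    (h : FinMod ((LinearMap.ker e).restrictScalars K ⊓ augRel ε ⊤) (augRel ε (LinearMap.ker e))) :
    FinMod ((LinearMap.ker d).restrictScalars K ⊓ augRel ε ⊤) (augRel ε (LinearMap.ker d)) := by
  obtain ⟨a₀, ha₀⟩ := Module.projective_lifting_property q p hq
  obtain ⟨b₀, hb₀⟩ := Module.projective_lifting_property p q hp
  have hpd : ∀ x, p (d x) = 0 := fun x => LinearMap.mem_ker.1 (hd ▸ ⟨x, rfl⟩)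
  have hqe : ∀ x, q (e x) = 0 := fun x => LinearMap.mem_ker.1 (he ▸ ⟨x, rfl⟩)
  have ha₀' : ∀ x, q (a₀ x) = p x := LinearMap.congr_fun ha₀
  have hb₀' : ∀ x, p (b₀ x) = q x := LinearMap.congr_fun hb₀
  obtain ⟨a₁, ha₁⟩ := exists_lift_of_range_eq_ker he (a₀ ∘ₗ d) fun x => by
    rw [LinearMap.comp_apply, ha₀', hpd]
  obtain ⟨b₁, hb₁⟩ := exists_lift_of_range_eq_ker hd (b₀ ∘ₗ e) fun x => by
    rw [LinearMap.comp_apply, hb₀', hqe]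
  obtain ⟨k, hk⟩ := exists_lift_of_range_eq_ker hd (b₀ ∘ₗ a₀ - LinearMap.id) fun x => by
    rw [LinearMap.sub_apply, map_sub, LinearMap.comp_apply, hb₀', ha₀', LinearMap.id_apply, sub_self]
  simp only [LinearMap.comp_apply, LinearMap.sub_apply, LinearMap.id_apply] at ha₁ hb₁ hk
  -- The comparison maps are inverse to each other up to the homotopy `k`. No next term of the
  -- resolution is needed: `c` takes values in `ker d`, so it sends `Ω P₁` into `Ω ker d`, and on
  -- cycles the term `k ∘ d` vanishes.
  let c : P₁ →ₗ[R] P₁ := b₁ ∘ₗ a₁ - LinearMap.id - k ∘ₗ d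
  have hc : ∀ x ∈ (⊤ : Submodule R P₁), c x ∈ LinearMap.ker d := by
    intro x _
    simp [c, ha₁, hb₁, hk]
  refine h.comap (a₁.restrictScalars K) ?_ ?_
  · rintro z ⟨hz, hz'⟩
    refine ⟨?_, map_mem_augRel a₁ (fun _ _ => Submodule.mem_top) hz'⟩
    have hz0 : d z = 0 := hz
    change e (a₁ z) = 0
    rw [ha₁, hz0, map_zero]
  · rintro z ⟨hz, hz'⟩ hza
    have hz0 : d z = 0 := hz
    have h1 : b₁ (a₁ z) ∈ augRel ε (LinearMap.ker d) := by
      refine map_mem_augRel b₁ (fun y hy => ?_) hza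
      have hy0 : e y = 0 := hy
      change d (b₁ y) = 0
      rw [hb₁, hy0, map_zero]
    have h2 := map_mem_augRel c hc hz'
    have h3 : z = b₁ (a₁ z) - c z := by simp [c, hz0]
    rw [h3]
    exact sub_mem h1 h2

end Comparison

/-! ### The second homology in terms of one-cycles. -/

namespace LieHomology

attribute [local instance] ModuleCat.moduleOfAlgebraModule
  ModuleCat.isScalarTower_of_algebra_moduleCat

lemma finiteDimensional_map_ker {K : Type u} [Field K] (S : ShortComplex (ModuleCat.{v} K))
    (h : Module.Finite K S.homology) {Y : Type*} [AddCommGroup Y] [Module K Y]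
    (φ : S.X₂ →ₗ[K] Y) (hφ : ∀ x, φ (S.f.hom x) = 0) :
    FiniteDimensional K ((LinearMap.ker S.g.hom).map φ) := by
  have e : S.homology ≃ₗ[K] (LinearMap.ker S.g.hom ⧸ LinearMap.range S.moduleCatToCycles) :=
    S.moduleCatHomologyIso.toLinearEquiv
  have : Module.Finite K (LinearMap.ker S.g.hom ⧸ LinearMap.range S.moduleCatToCycles) :=
    Module.Finite.equiv e
  have hle : LinearMap.range S.moduleCatToCycles ≤
      LinearMap.ker (φ ∘ₗ (LinearMap.ker S.g.hom).subtype) := by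
    rintro _ ⟨x, rfl⟩
    exact hφ x
  have h1 : (LinearMap.ker S.g.hom).map φ ≤
      LinearMap.range ((LinearMap.range S.moduleCatToCycles).liftQ _ hle) := by
    rintro _ ⟨x, hx, rfl⟩
    exact ⟨Submodule.Quotient.mk ⟨x, hx⟩, rfl⟩
  exact Submodule.finiteDimensional_of_le h1

variable {K : Type u} [Field K] {L : Type v} [LieRing L] [LieAlgebra K L]

/-- With `Z = ker d₁` and `Ω` the augmentation ideal, dimension shifting identifies the second
homology with the kernel of `Z/ΩZ → P₁/ΩP₁`, that is, with `(Z ∩ ΩP₁)/ΩZ`. Only the surjection onto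
the latter is needed. -/
lemma finMod_cycles_of_finite_homology {T : ModuleCat.{max u v} (UniversalEnvelopingAlgebra K L)}
    (h : Module.Finite K (homology K L 2 T)) (Q : ProjectiveResolution T) :
    FinMod ((LinearMap.ker (Q.complex.d 1 0).hom).restrictScalars K ⊓
        augRel (augmentation K L) (⊤ : Submodule (UniversalEnvelopingAlgebra K L) (Q.complex.X 1)))
      (augRel (augmentation K L) (LinearMap.ker (Q.complex.d 1 0).hom)) := by
  let C := ((trivialTensor K L).mapHomologicalComplex (ComplexShape.down ℕ)).obj Q.complex
  have e : homology K L 2 T ≅ (C.sc' 3 2 1).homology :=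
    Q.isoLeftDerivedObj (trivialTensor K L) 2 ≪≫ C.homologyIsoSc' 3 2 1 (by simp) (by simp)
  have hfin : Module.Finite K (C.sc' 3 2 1).homology := Module.Finite.equiv e.toLinearEquiv
  let d₂ := (Q.complex.d 2 1).hom
  let d₁ := (Q.complex.d 1 0).hom
  have hd₁₂ : ∀ x, d₁ (d₂ x) = 0 := fun x => by
    have := Q.complex.d_comp_d 2 1 0
    exact congrArg (fun f => f.hom x) this
  have hd₂₃ : ∀ x, d₂ ((Q.complex.d 3 2).hom x) = 0 := fun x => by
    have := Q.complex.d_comp_d 3 2 1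
    exact congrArg (fun f => f.hom x) this
  have hrel : ∀ V : ModuleCat.{max u v} (UniversalEnvelopingAlgebra K L),
      relations K L V = augRel (augmentation K L) ⊤ := by
    intro V
    simp [relations, augRel]
  -- The surjection is induced by `d₂`: a lift to `P₂` of an element of `Z ∩ ΩP₁` is a cycle after
  -- tensoring with `K`.
  let Y := Q.complex.X 1 ⧸ augRel (augmentation K L) (LinearMap.ker d₁)
  let φ : (C.sc' 3 2 1).X₂ →ₗ[K] Y :=
    (relations K L (Q.complex.X 2)).liftQ ((Submodule.mkQ _) ∘ₗ d₂.restrictScalars K) (by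
      intro z hz
      rw [hrel] at hz
      exact (Submodule.Quotient.mk_eq_zero _).2 (map_mem_augRel d₂ (fun x _ => hd₁₂ x) hz))
  have hφ : ∀ x, φ ((C.sc' 3 2 1).f.hom x) = 0 := by
    intro x
    obtain ⟨x, rfl⟩ := Submodule.Quotient.mk_surjective (relations K L (Q.complex.X 3)) x
    change (Submodule.mkQ _) (d₂ ((Q.complex.d 3 2).hom x)) = 0
    rw [hd₂₃, map_zero]
  have := finiteDimensional_map_ker _ hfin φ hφ
  refine Submodule.finiteDimensional_of_le (S₂ := (LinearMap.ker (C.sc' 3 2 1).g.hom).map φ) ?_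
  rintro _ ⟨z, ⟨hz, hz'⟩, rfl⟩
  have hex := (ShortComplex.moduleCat_exact_iff _).1 (Q.exact_succ 0) z hz
  obtain ⟨y, hy⟩ := hex
  refine ⟨Submodule.Quotient.mk y, ?_, ?_⟩
  · change (Submodule.Quotient.mk (d₂ y) : _ ⧸ relations K L (Q.complex.X 1)) = 0
    rw [Submodule.Quotient.mk_eq_zero, hrel]
    exact hy ▸ hz'
  · change (Submodule.mkQ _) (d₂ y) = _
    exact congrArg _ hy

/-- If the second homology of `L` is finite-dimensional, then so is the one computed from any start
of a projective resolution of the trivial module. -/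
lemma finMod_cycles (h : Module.Finite K (homology K L 2 (trivialModule K L)))
    {P : Type (max u v)} [AddCommGroup P] [Module (UniversalEnvelopingAlgebra K L) P] [Module K P]
    [IsScalarTower K (UniversalEnvelopingAlgebra K L) P]
    [Module.Projective (UniversalEnvelopingAlgebra K L) P]
    (d : P →ₗ[UniversalEnvelopingAlgebra K L] UniversalEnvelopingAlgebra K L)
    (hd : ∀ r, augmentation K L r = 0 ↔ ∃ x, d x = r) :
    FinMod ((LinearMap.ker d).restrictScalars K ⊓ augRel (augmentation K L) ⊤)
      (augRel (augmentation K L) (LinearMap.ker d)) := by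
  obtain ⟨⟨Q⟩⟩ := (inferInstance : HasProjectiveResolution (trivialModule K L))
  have hQ := finMod_cycles_of_finite_homology h Q
  have hproj : ∀ n, Module.Projective (UniversalEnvelopingAlgebra K L) (Q.complex.X n) := fun n =>
    have := Q.projective n
    (Q.complex.X n).projective_of_module_projective
  have smul_def : ∀ (r : UniversalEnvelopingAlgebra K L) (c : K),
      (r • (show trivialModule K L from ULift.up c)) =
        (show trivialModule K L from ULift.up (augmentation K L r * c)) := fun r c => rfl
  let η : UniversalEnvelopingAlgebra K L →ₗ[UniversalEnvelopingAlgebra K L] trivialModule K L :=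
    LinearMap.toSpanSingleton _ _ (show trivialModule K L from ULift.up (1 : K))
  have hη : ∀ r, η r = (show trivialModule K L from ULift.up (augmentation K L r)) := fun r => by
    rw [LinearMap.toSpanSingleton_apply, smul_def, mul_one]
  refine finMod_cycles_of_projective η d (Q.π.f 0).hom (Q.complex.d 1 0).hom ?_ ?_ ?_ ?_ hQ
  · rintro ⟨c⟩
    refine ⟨algebraMap K _ c, ?_⟩
    rw [hη, AlgHom.commutes]
    rfl
  · exact (ModuleCat.epi_iff_surjective _).1 inferInstance
  · ext r
    rw [LinearMap.mem_range, ← hd r, LinearMap.mem_ker, hη]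
    exact ⟨fun h => by rw [h]; rfl, fun h => congrArg ULift.down h⟩
  · exact Q.exact₀.moduleCat_range_eq_ker

end LieHomology

/-! ### Words and ideals in free algebras. -/

namespace FreeMonoidAlgebra

open MonoidAlgebra

variable {K X : Type*} [Field K]

/-- The part of `f` consisting of the words ending in `u`, with this ending removed. -/
def stripRight (u : FreeMonoid X) : MonoidAlgebra K (FreeMonoid X) →ₗ[K]
    MonoidAlgebra K (FreeMonoid X) where
  toFun f := .ofCoeff (f.coeff.comapDomain (· * u) (mul_left_injective u).injOn)
  map_add' f g := by ext; rfl
  map_smul' c f := by ext; rfl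

/-- The part of `f` consisting of the words beginning with `u`, with this beginning removed. -/
def stripLeft (u : FreeMonoid X) : MonoidAlgebra K (FreeMonoid X) →ₗ[K]
    MonoidAlgebra K (FreeMonoid X) where
  toFun f := .ofCoeff (f.coeff.comapDomain (u * ·) (mul_right_injective u).injOn)
  map_add' f g := by ext; rfl
  map_smul' c f := by ext; rfl

lemma coeff_stripRight (u : FreeMonoid X) (f : MonoidAlgebra K (FreeMonoid X))
    (w : FreeMonoid X) : (stripRight u f).coeff w = f.coeff (w * u) := rfl

lemma coeff_stripLeft (u : FreeMonoid X) (f : MonoidAlgebra K (FreeMonoid X))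
    (w : FreeMonoid X) : (stripLeft u f).coeff w = f.coeff (u * w) := rfl

lemma mul_of_eq_mul_of {a b : FreeMonoid X} {x y : X}
    (h : a * FreeMonoid.of x = b * FreeMonoid.of y) : a = b ∧ x = y := by
  have h1 : a.toList ++ [x] = b.toList ++ [y] := congrArg FreeMonoid.toList h
  have := List.append_inj' h1 rfl
  exact ⟨FreeMonoid.toList.injective this.1, by simpa using this.2⟩

lemma of_mul_eq_of_mul {a b : FreeMonoid X} {x y : X}
    (h : FreeMonoid.of x * a = FreeMonoid.of y * b) : x = y ∧ a = b := by
  have h1 : x :: a.toList = y :: b.toList := congrArg FreeMonoid.toList h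
  rw [List.cons.injEq] at h1
  exact ⟨h1.1, FreeMonoid.toList.injective h1.2⟩

lemma one_ne_of_mul (x : X) (t : FreeMonoid X) : 1 ≠ FreeMonoid.of x * t := by
  intro h
  have := congrArg FreeMonoid.length h
  rw [FreeMonoid.length_one, FreeMonoid.length_mul, FreeMonoid.length_of] at this
  omega

lemma stripRight_mul_of (x y : X) [Decidable (x = y)] (f : MonoidAlgebra K (FreeMonoid X)) :
    stripRight (FreeMonoid.of x) (f * single (FreeMonoid.of y) 1) = if x = y then f else 0 := by
  ext w
  rw [coeff_stripRight]
  split_ifs with h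
  · subst h
    rw [coeff_mul_single_mul, mul_one]
  · rw [coeff_mul_single_of_forall_mul_ne]
    · rfl
    · intro d hd
      exact h (mul_of_eq_mul_of hd).2.symm

lemma exists_eq_add_sum_mul_of (f : MonoidAlgebra K (FreeMonoid X)) :
    ∃ c : X →₀ MonoidAlgebra K (FreeMonoid X),
      f = single 1 (f.coeff 1) + c.sum fun x a => a * single (FreeMonoid.of x) 1 := by
  classical
  induction f using MonoidAlgebra.induction_linear with
  | zero => exact ⟨0, by simp⟩
  | add f g hf hg =>
    obtain ⟨c, hc⟩ := hf
    obtain ⟨c', hc'⟩ := hg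
    refine ⟨c + c', ?_⟩
    rw [Finsupp.sum_add_index' (by simp) (by simp [add_mul])]
    conv_lhs => rw [hc, hc']
    rw [coeff_add, Finsupp.add_apply, single_add]
    abel
  | single w r =>
    induction w using FreeMonoid.inductionOn' with
    | one => exact ⟨0, by simp⟩
    | of_mul x w ih =>
      clear ih
      rcases List.eq_nil_or_concat (FreeMonoid.toList (FreeMonoid.of x * w)) with h | ⟨l, y, h⟩
      · simp at h
      · have hw : FreeMonoid.of x * w = FreeMonoid.ofList l * FreeMonoid.of y :=
          FreeMonoid.toList.injective (by simpa using h)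
        refine ⟨Finsupp.single y (single (FreeMonoid.ofList l) r), ?_⟩
        rw [Finsupp.sum_single_index (by simp), single_mul_single, mul_one, ← hw, coeff_single,
          Finsupp.single_eq_of_ne, single_zero, zero_add]
        exact one_ne_of_mul x w

lemma eq_zero_of_sum_mul_of_eq_zero {c : X →₀ MonoidAlgebra K (FreeMonoid X)}
    (h : (c.sum fun x a => a * single (FreeMonoid.of x) 1) = 0) (x : X) : c x = 0 := by
  classical
  have := congrArg (stripRight (FreeMonoid.of x)) h
  rw [Finsupp.sum, map_sum] at this
  simp only [stripRight_mul_of, map_zero] at this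
  rw [Finset.sum_ite_eq] at this
  by_contra h0
  rw [if_pos (Finsupp.mem_support_iff.2 h0)] at this
  exact h0 this

/-- A nonzero left ideal of a free algebra of rank at least two which, with each element without
constant term, contains its right coefficients, is the unit ideal. -/
lemma one_mem_of_stripRight_mem {P : MonoidAlgebra K (FreeMonoid X) → Prop}
    (hmul : ∀ g f, P f → P (g * f))
    (hstrip : ∀ x f, P f → f.coeff 1 = 0 → P (stripRight (FreeMonoid.of x) f))
    {f : MonoidAlgebra K (FreeMonoid X)} (hf : P f) (hf0 : f ≠ 0) [Nontrivial X] : P 1 := by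
  classical
  -- The letters of `u` are removed from the last to the first; the bound on lengths ensures that
  -- there is never a constant term on the way.
  have strip : ∀ (u : FreeMonoid X) (g : MonoidAlgebra K (FreeMonoid X)), P g →
      (∀ s : FreeMonoid X, s.length < u.length → g.coeff s = 0) → P (stripRight u g) := by
    intro u
    induction u using FreeMonoid.inductionOn' with
    | one =>
      intro g hg _
      have : stripRight 1 g = g := by ext w; rw [coeff_stripRight, mul_one]
      rwa [this]
    | of_mul x u ih =>
      intro g hg h
      rw [FreeMonoid.length_mul, FreeMonoid.length_of] at h
      have h1 := ih g hg fun s hs => h s (by omega)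
      have h2 := hstrip x _ h1 (by rw [coeff_stripRight, one_mul]; exact h u (by omega))
      have : stripRight (FreeMonoid.of x * u) g = stripRight (FreeMonoid.of x) (stripRight u g) := by
        ext w
        rw [coeff_stripRight, coeff_stripRight, coeff_stripRight, mul_assoc]
      rwa [this]
  have hne : f.coeff.support.Nonempty := by
    rw [Finsupp.support_nonempty_iff]
    simpa using hf0
  obtain ⟨u, hu, hmax⟩ := f.coeff.support.exists_max_image FreeMonoid.length hne
  -- Rank at least two provides a letter with which the longest word `u` does not begin. Multiplying
  -- `f` on the left by the power `w = j ^ |u|` makes all words long enough to strip `u`.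
  obtain ⟨j, hj⟩ : ∃ j : X, ∀ t, u ≠ FreeMonoid.of j * t := by
    cases u using FreeMonoid.casesOn with
    | one =>
      obtain ⟨j, _⟩ := exists_pair_ne X
      exact ⟨j, fun t => one_ne_of_mul j t⟩
    | of_mul x u =>
      obtain ⟨j, hj⟩ := exists_ne x
      exact ⟨j, fun t ht => hj (of_mul_eq_of_mul ht).1.symm⟩
  set w : FreeMonoid X := FreeMonoid.ofList (List.replicate u.length j) with hw
  have hwl : w.length = u.length := List.length_replicate
  have hg0 : ∀ s, (∀ v ∈ f.coeff.support, s ≠ w * v) → (single w (1 : K) * f).coeff s = 0 := by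
    intro s hs
    by_cases h : ∃ d, w * d = s
    · obtain ⟨d, rfl⟩ := h
      rw [coeff_single_mul_mul, one_mul]
      by_contra hd
      exact hs d (Finsupp.mem_support_iff.2 hd) rfl
    · exact coeff_single_mul_of_forall_mul_ne _ _ fun d hd => h ⟨d, hd⟩
  have h1 := strip u _ (hmul (single w 1) f hf) fun s hs => hg0 s fun v _ hv => by
    rw [hv, FreeMonoid.length_mul] at hs
    omega
  have h2 : stripRight u (single w 1 * f) = single w (f.coeff u) := by
    ext t
    rw [coeff_stripRight, coeff_single]
    by_cases ht : w = t
    · subst ht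
      rw [coeff_single_mul_mul, one_mul, Finsupp.single_eq_same]
    · rw [Finsupp.single_eq_of_ne (Ne.symm ht)]
      refine hg0 _ fun v hv htv => ?_
      have hlen := congrArg FreeMonoid.length htv
      rw [FreeMonoid.length_mul, FreeMonoid.length_mul, hwl] at hlen
      have hv' := hmax v hv
      have hl : t.toList ++ u.toList = w.toList ++ v.toList := congrArg FreeMonoid.toList htv
      -- From `t u = w v` with `v` no longer than `u`, the word `t` is a prefix of `w`. If it were a
      -- proper one, `u` would begin with the letter `j`. So the only word of `w * f` ending in `u`
      -- is `w u`.
      rcases List.append_eq_append_iff.1 hl with ⟨s, hs1, hs2⟩ | ⟨s, hs1, hs2⟩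
      · rcases s with _ | ⟨x, s⟩
        · rw [List.append_nil] at hs1
          exact ht (FreeMonoid.toList.injective hs1)
        · have hx : x ∈ w.toList := by rw [hs1]; simp
          have : x = j := List.eq_of_mem_replicate hx
          subst this
          exact hj (FreeMonoid.ofList (s ++ v.toList)) (FreeMonoid.toList.injective (by
            simpa using hs2))
      · have hl1 := congrArg List.length hs1
        rw [List.length_append] at hl1
        have e1 : t.toList.length = t.length := rfl
        have e2 : w.toList.length = w.length := rfl
        have : s.length = 0 := by omega
        rw [List.length_eq_zero_iff] at this
        rw [this, List.append_nil] at hs1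
        exact ht (FreeMonoid.toList.injective hs1.symm)
  rw [h2] at h1
  have h3 := strip w _ h1 fun s hs => by
    rw [coeff_single, Finsupp.single_eq_of_ne]
    rintro rfl
    exact lt_irrefl _ hs
  have h4 : stripRight w (single w (f.coeff u)) = single 1 (f.coeff u) := by
    ext t
    rw [coeff_stripRight, coeff_single, coeff_single]
    by_cases ht : t = 1
    · subst ht
      rw [one_mul, Finsupp.single_eq_same, Finsupp.single_eq_same]
    · rw [Finsupp.single_eq_of_ne ht, Finsupp.single_eq_of_ne]
      intro h
      exact ht (by simpa using h)
  rw [h4] at h3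
  have h5 := hmul (single 1 (f.coeff u)⁻¹) _ h3
  rwa [single_mul_single, one_mul, inv_mul_cancel₀ (Finsupp.mem_support_iff.1 hu),
    ← one_def] at h5

/-- The augmentation of the free algebra. -/
def aug : MonoidAlgebra K (FreeMonoid X) →ₐ[K] K :=
  MonoidAlgebra.lift K K (FreeMonoid X) (FreeMonoid.lift fun _ => 0)

lemma aug_apply (f : MonoidAlgebra K (FreeMonoid X)) : aug f = f.coeff 1 := by
  induction f using MonoidAlgebra.induction_linear with
  | zero => simp
  | add f g hf hg => rw [map_add, hf, hg]; rfl
  | single w r =>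
    rw [aug, lift_single, coeff_single]
    cases w using FreeMonoid.casesOn with
    | one => simp
    | of_mul x u =>
      rw [Finsupp.single_eq_of_ne]
      · simp
      · exact one_ne_of_mul x u

/-- The product rule for Fox derivatives: the first letter comes from `f`, unless the word taken
from `f` is empty. -/
lemma stripLeft_mul (x : X) (f g : MonoidAlgebra K (FreeMonoid X)) :
    stripLeft (FreeMonoid.of x) (f * g) =
      stripLeft (FreeMonoid.of x) f * g + f.coeff 1 • stripLeft (FreeMonoid.of x) g := by
  classical
  induction f using MonoidAlgebra.induction_linear with
  | zero => simp
  | add f g hf hg =>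
    rw [add_mul, map_add, hf, hg, map_add, add_mul, coeff_add, Finsupp.add_apply, add_smul]
    abel
  | single w r =>
    cases w using FreeMonoid.casesOn with
    | one =>
      have h1 : single (1 : FreeMonoid X) r * g = r • g := by
        rw [← smul_eq_mul (single 1 r) g, ← mul_one r, ← smul_eq_mul r 1, ← smul_single, ← one_def]
        simp
      have h2 : stripLeft (FreeMonoid.of x) (single (1 : FreeMonoid X) r) = 0 := by
        ext t
        rw [coeff_stripLeft, coeff_single, Finsupp.single_eq_of_ne]
        · rfl
        · exact (one_ne_of_mul x t).symm
      rw [h1, h2, map_smul, zero_mul, zero_add, coeff_single, Finsupp.single_eq_same]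
    | of_mul y u =>
      rw [coeff_single, Finsupp.single_eq_of_ne (one_ne_of_mul y u), zero_smul, add_zero]
      by_cases hxy : y = x
      · subst hxy
        have h1 : stripLeft (FreeMonoid.of y) (single (FreeMonoid.of y * u) r) = single u r := by
          ext t
          rw [coeff_stripLeft, coeff_single, coeff_single]
          by_cases ht : t = u
          · subst ht
            rw [Finsupp.single_eq_same, Finsupp.single_eq_same]
          · rw [Finsupp.single_eq_of_ne ht, Finsupp.single_eq_of_ne]
            intro h
            exact ht (mul_left_cancel h)
        rw [h1]
        ext t
        have h2 : single (FreeMonoid.of y * u) r = single (FreeMonoid.of y) 1 * single u r := by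
          rw [single_mul_single, one_mul]
        rw [coeff_stripLeft, h2, mul_assoc, coeff_single_mul_mul, one_mul]
      · have h1 : stripLeft (FreeMonoid.of x) (single (FreeMonoid.of y * u) r) = 0 := by
          ext t
          rw [coeff_stripLeft, coeff_single, Finsupp.single_eq_of_ne]
          · rfl
          · intro h
            exact hxy (of_mul_eq_of_mul h).1.symm
        rw [h1, zero_mul]
        ext t
        rw [coeff_stripLeft, coeff_single_mul_of_forall_mul_ne]
        · rfl
        · intro d h
          rw [mul_assoc] at h
          exact hxy (of_mul_eq_of_mul h).1

lemma exists_eq_add_sum_of_mul (f : MonoidAlgebra K (FreeMonoid X)) :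
    ∃ s : Finset X, f = single 1 (f.coeff 1) +
      ∑ x ∈ s, single (FreeMonoid.of x) 1 * stripLeft (FreeMonoid.of x) f := by
  classical
  refine ⟨f.coeff.support.biUnion fun w => w.toList.toFinset, ?_⟩
  ext t
  rw [coeff_add, Finsupp.add_apply, coeff_sum, Finsupp.finsetSum_apply, coeff_single]
  cases t using FreeMonoid.casesOn with
  | one =>
    rw [Finsupp.single_eq_same, Finset.sum_eq_zero, add_zero]
    intro x _
    exact coeff_single_mul_of_forall_mul_ne _ _ fun d =>
      (one_ne_of_mul x d).symm
  | of_mul y u =>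
    rw [Finsupp.single_eq_of_ne (one_ne_of_mul y u).symm, zero_add]
    have h1 : ∀ x, x ≠ y → (single (FreeMonoid.of x) (1 : K) * stripLeft (FreeMonoid.of x) f).coeff
        (FreeMonoid.of y * u) = 0 := fun x hx =>
      coeff_single_mul_of_forall_mul_ne _ _ fun d h => hx (of_mul_eq_of_mul h).1
    rw [Finset.sum_eq_single y (fun x _ hx => h1 x hx), coeff_single_mul_mul, one_mul,
      coeff_stripLeft]
    intro hy
    rw [coeff_single_mul_mul, one_mul, coeff_stripLeft]
    by_contra h
    exact hy (Finset.mem_biUnion.2 ⟨_, Finsupp.mem_support_iff.2 h, by simp⟩)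

/-- Let `q` be a map from a free algebra onto an infinite-dimensional domain, compatible with the
augmentation. If its kernel `E` is finite-dimensional modulo the product of the augmentation ideal
with `E`, then `q` is injective. -/
lemma injective_of_finMod_ker {Q : Type*} [Ring Q] [NoZeroDivisors Q] [Algebra K Q]
    (q : MonoidAlgebra K (FreeMonoid X) →ₐ[K] Q) (hq : Function.Surjective q)
    (hQ : ¬ Module.Finite K Q) (haug : ∀ f, q f = 0 → aug f = 0)
    (h : FinMod ((RingHom.ker q).restrictScalars K) (augRel aug (RingHom.ker q))) :
    Function.Injective q := by
  have hD : ∀ x, ∀ v ∈ augRel (aug (K := K) (X := X)) (RingHom.ker q),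
      q (stripLeft (FreeMonoid.of x) v) = 0 := by
    intro x v hv
    induction hv using Submodule.span_induction with
    | mem v hv =>
      obtain ⟨a, z, hz, rfl⟩ := hv
      have hz : q z = 0 := hz
      rw [map_sub, smul_eq_mul, stripLeft_mul, aug_apply, map_smul, add_sub_cancel_right, map_mul,
        hz, mul_zero]
    | zero => simp
    | add v w _ _ hv hw => rw [map_add, map_add, hv, hw, add_zero]
    | smul c v _ hv => rw [map_smul, map_smul, hv, smul_zero]
  -- Write `E = ker q` and `D = ΩE`. For `b ∈ E` outside `D`, some left coefficient of `b` lies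
  -- outside `E`, since `b` is the sum of its left coefficients multiplied by letters.
  have hsub : ∀ b, q b = 0 → b ∈ augRel (aug (K := K) (X := X)) (RingHom.ker q) := by
    by_contra! hcon
    obtain ⟨b, hb, hbD⟩ := hcon
    obtain ⟨s, hs⟩ := exists_eq_add_sum_of_mul b
    rw [← aug_apply, haug b hb, single_zero, zero_add] at hs
    obtain ⟨x, hx⟩ : ∃ x, q (stripLeft (FreeMonoid.of x) b) ≠ 0 := by
      by_contra! hall
      refine hbD ?_
      rw [hs]
      refine Submodule.sum_mem _ fun x _ => smul_mem_augRel ?_ (hall x)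
      rw [aug_apply, coeff_single, Finsupp.single_eq_of_ne]
      intro h
      simpa using congrArg FreeMonoid.length h
    have htop : FinMod (⊤ : Submodule K (MonoidAlgebra K (FreeMonoid X)))
        ((RingHom.ker q).restrictScalars K) := by
      -- The map `u ↦ b * u` embeds `Q` into `E/D`: if `b * u ∈ D`, its left coefficient at `x` lies
      -- in `E`, and that coefficient is the one of `b` times `u`. As `Q` is a domain, `u ∈ E`.
      refine h.comap (LinearMap.mulLeft K b) ?_ ?_
      · intro u _
        change q (b * u) = 0
        rw [map_mul, hb, zero_mul]
      · intro u _ hu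
        have := hD x _ hu
        rw [LinearMap.mulLeft_apply, stripLeft_mul, ← aug_apply, haug b hb, zero_smul, add_zero,
          map_mul] at this
        exact (mul_eq_zero.1 this).resolve_left hx
    refine hQ ?_
    have h1 : FinMod ((⊤ : Submodule K (MonoidAlgebra K (FreeMonoid X))).map q.toLinearMap)
        (⊥ : Submodule K Q) := htop.map q.toLinearMap (by
      rintro _ ⟨u, hu, rfl⟩
      exact hu)
    rw [Submodule.map_top, LinearMap.range_eq_top.2 hq] at h1
    have h2 : FiniteDimensional K ((⊤ : Submodule K Q).map (⊥ : Submodule K Q).mkQ) := h1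
    rw [Submodule.map_top, Submodule.range_mkQ] at h2
    have : FiniteDimensional K (Q ⧸ (⊥ : Submodule K Q)) := Module.Finite.equiv Submodule.topEquiv
    exact Module.Finite.equiv (Submodule.quotEquivOfEqBot (⊥ : Submodule K Q) rfl)
  rw [injective_iff_map_eq_zero]
  intro b hb
  ext w
  change b.coeff w = 0
  -- Now `E = D`, so `E` is stable under taking left coefficients. Stripping letters turns every
  -- coefficient of `b` into a constant term of an element of `E`, which is zero.
  induction w using FreeMonoid.inductionOn' generalizing b with
  | one => rw [← aug_apply, haug b hb]
  | of_mul x w ih => exact ih _ (hD x b (hsub b hb))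

end FreeMonoidAlgebra

/-! ### Functoriality of enveloping algebras. -/

namespace UniversalEnvelopingAlgebra

attribute [local instance 100] LieRing.ofAssociativeRing

variable {K : Type u} [Field K] {L L' L'' : Type v} [LieRing L] [LieAlgebra K L]
  [LieRing L'] [LieAlgebra K L'] [LieRing L''] [LieAlgebra K L'']

/-- The homomorphism of universal enveloping algebras induced by a morphism of Lie algebras. -/
def map (f : L →ₗ⁅K⁆ L') : UniversalEnvelopingAlgebra K L →ₐ[K] UniversalEnvelopingAlgebra K L' :=
  lift K ((ι K).comp f)

lemma map_ι (f : L →ₗ⁅K⁆ L') (x : L) : map f (ι K x) = ι K (f x) := by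
  rw [map, lift_ι_apply]
  rfl

lemma map_surjective {f : L →ₗ⁅K⁆ L'} (hf : Function.Surjective f) :
    Function.Surjective (map f) := by
  rw [← AlgHom.range_eq_top]
  refine PBW.subalgebra_eq_top _ fun y => ?_
  obtain ⟨x, rfl⟩ := hf y
  exact ⟨ι K x, map_ι f x⟩

lemma augmentation_ι (x : L) : LieHomology.augmentation K L (ι K x) = 0 := by
  rw [LieHomology.augmentation, lift_ι_apply]
  rfl

lemma augmentation_map (f : L →ₗ⁅K⁆ L') (u : UniversalEnvelopingAlgebra K L) :
    LieHomology.augmentation K L' (map f u) = LieHomology.augmentation K L u := by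
  have : (LieHomology.augmentation K L').comp (map f) = LieHomology.augmentation K L := by
    apply hom_ext
    ext x
    change LieHomology.augmentation K L' (map f (ι K x)) = LieHomology.augmentation K L (ι K x)
    rw [map_ι, augmentation_ι, augmentation_ι]
  exact AlgHom.congr_fun this u

/-- The kernel of the homomorphism of universal enveloping algebras induced by a surjective morphism
of Lie algebras is generated, as a left ideal, by the kernel of this morphism. -/
lemma ker_map {f : L →ₗ⁅K⁆ L'} (hf : Function.Surjective f) :
    RingHom.ker (map f) = Ideal.span (ι K '' {x | f x = 0}) := by
  set J : Ideal (UniversalEnvelopingAlgebra K L) := Ideal.span (ι K '' {x | f x = 0}) with hJ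
  -- The left ideal is two-sided because `k x = x k + [k, x]` and `[k, x]` is again in the kernel.
  -- The quotient by it then receives a map from the enveloping algebra of `L'`.
  have hJι : ∀ v ∈ J, ∀ x : L, v * ι K x ∈ J := by
    intro v hv x
    induction hv using Submodule.span_induction with
    | mem v hv =>
      obtain ⟨k, hk, rfl⟩ := hv
      have hk : f k = 0 := hk
      rw [PBW.ι_mul_ι]
      refine J.add_mem (J.mul_mem_left _ (Submodule.subset_span ⟨k, hk, rfl⟩))
        (Submodule.subset_span ⟨_, ?_, rfl⟩)
      change f ⁅k, x⁆ = 0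
      rw [LieHom.map_lie, hk, zero_lie]
    | zero => rw [zero_mul]; exact J.zero_mem
    | add v w _ _ hv hw => rw [add_mul]; exact J.add_mem hv hw
    | smul a v _ hv => rw [smul_eq_mul, mul_assoc]; exact J.mul_mem_left a hv
  have htwo : J.IsTwoSided := by
    let S : Subalgebra K (UniversalEnvelopingAlgebra K L) :=
      { carrier := {u | ∀ v ∈ J, v * u ∈ J}
        mul_mem' := fun {a b} ha hb v hv => by rw [← mul_assoc]; exact hb _ (ha v hv)
        add_mem' := fun {a b} ha hb v hv => by rw [mul_add]; exact J.add_mem (ha v hv) (hb v hv)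
        algebraMap_mem' := fun c v hv => by
          rw [← Algebra.commutes]
          exact J.mul_mem_left _ hv }
    have : S = ⊤ := PBW.subalgebra_eq_top S fun x v hv => hJι v hv x
    refine ⟨fun {v} u hv => ?_⟩
    have hu : u ∈ S := this ▸ Algebra.mem_top
    exact hu v hv
  refine le_antisymm ?_ ?_
  · let m := Ideal.Quotient.mkₐ K J
    have hm : ∀ x y : L, f x = f y → m (ι K x) = m (ι K y) := by
      intro x y h
      rw [← sub_eq_zero, ← map_sub, ← map_sub]
      refine Ideal.Quotient.eq_zero_iff_mem.2 (Submodule.subset_span ⟨_, ?_, rfl⟩)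
      change f (x - y) = 0
      rw [map_sub, h, sub_self]
    let s := Function.surjInv hf
    have hs : ∀ y, f (s y) = y := Function.surjInv_eq hf
    let g : L' →ₗ⁅K⁆ (UniversalEnvelopingAlgebra K L ⧸ J) :=
      { toFun := fun y => m (ι K (s y))
        map_add' := fun x y => by
          rw [← map_add, ← map_add]
          exact hm _ _ (by rw [map_add, hs, hs, hs])
        map_smul' := fun c x => by
          rw [RingHom.id_apply, ← map_smul, ← map_smul]
          exact hm _ _ (by rw [map_smul, hs, hs])
        map_lie' := fun {x y} => by
          rw [hm (s ⁅x, y⁆) ⁅s x, s y⁆ (by rw [LieHom.map_lie, hs, hs, hs]), LieHom.map_lie,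
            LieRing.of_associative_ring_bracket, LieRing.of_associative_ring_bracket, map_sub,
            map_mul, map_mul] }
    have hcomp : (lift K g).comp (map f) = m := by
      apply hom_ext
      ext x
      change lift K g (map f (ι K x)) = m (ι K x)
      rw [map_ι, lift_ι_apply]
      exact hm _ _ (hs _)
    intro u hu
    have hu : map f u = 0 := hu
    have h1 := AlgHom.congr_fun hcomp u
    rw [AlgHom.comp_apply, hu, map_zero] at h1
    exact Ideal.Quotient.eq_zero_iff_mem.1 h1.symm
  · refine Ideal.span_le.2 ?_
    rintro _ ⟨x, hx, rfl⟩
    have hx : f x = 0 := hx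
    change map f (ι K x) = 0
    rw [map_ι, hx, map_zero]

/-- The universal enveloping algebra of a free Lie algebra is a free algebra. -/
lemma exists_algEquiv_of_bijective_lift {X : Set L}
    (h : Function.Bijective (FreeLieAlgebra.lift K (fun x : X => (x : L)))) :
    ∃ e : UniversalEnvelopingAlgebra K L ≃ₐ[K] MonoidAlgebra K (FreeMonoid X),
      ∀ x : X, e (ι K (x : L)) = MonoidAlgebra.single (FreeMonoid.of x) 1 := by
  let E : FreeLieAlgebra K X ≃ₗ⁅K⁆ L := LieEquiv.ofBijective _ h
  have hE : ∀ x : X, E.symm (x : L) = FreeLieAlgebra.of K x := fun x => by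
    rw [LieEquiv.symm_apply_eq]
    exact (FreeLieAlgebra.lift_of_apply _ _).symm
  let φ : FreeLieAlgebra K X →ₗ⁅K⁆ MonoidAlgebra K (FreeMonoid X) :=
    FreeLieAlgebra.lift K fun x => MonoidAlgebra.single (FreeMonoid.of x) 1
  let F : UniversalEnvelopingAlgebra K L →ₐ[K] MonoidAlgebra K (FreeMonoid X) :=
    lift K (φ.comp (E.symm : L →ₗ⁅K⁆ FreeLieAlgebra K X))
  let G : MonoidAlgebra K (FreeMonoid X) →ₐ[K] UniversalEnvelopingAlgebra K L :=
    MonoidAlgebra.lift K _ _ (FreeMonoid.lift fun x : X => ι K (x : L))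
  have hF : ∀ x : X, F (ι K (x : L)) = MonoidAlgebra.single (FreeMonoid.of x) 1 := fun x => by
    rw [lift_ι_apply]
    change φ (E.symm x) = _
    rw [hE, FreeLieAlgebra.lift_of_apply]
  have hG : ∀ x : X, G (MonoidAlgebra.single (FreeMonoid.of x) 1) = ι K (x : L) := fun x => by
    rw [MonoidAlgebra.lift_single, one_smul, FreeMonoid.lift_eval_of]
  refine ⟨AlgEquiv.ofAlgHom F G ?_ ?_, hF⟩
  · refine MonoidAlgebra.algHom_ext' (FreeMonoid.hom_eq fun x => ?_) (by ext)
    change F (G (MonoidAlgebra.single (FreeMonoid.of x) 1)) = _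
    rw [hG, hF]
    rfl
  · apply hom_ext
    have : ((((G.comp F : _ →ₐ[K] UniversalEnvelopingAlgebra K L) :
        UniversalEnvelopingAlgebra K L →ₗ⁅K⁆ UniversalEnvelopingAlgebra K L).comp (ι K)).comp
          (E : FreeLieAlgebra K X →ₗ⁅K⁆ L)) = (ι K).comp (E : FreeLieAlgebra K X →ₗ⁅K⁆ L) := by
      refine FreeLieAlgebra.hom_ext fun x => ?_
      have hx : E (FreeLieAlgebra.of K x) = x := FreeLieAlgebra.lift_of_apply _ _
      change G (F (ι K (E (FreeLieAlgebra.of K x)))) = ι K (E (FreeLieAlgebra.of K x))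
      rw [hx, hF, hG]
    ext y
    obtain ⟨z, rfl⟩ := E.surjective y
    exact LieHom.congr_fun this z

end UniversalEnvelopingAlgebra

/-- Up to a finite-dimensional complement, `S` consists of elements that `f` sends into `D'`, so it
suffices to control `g` on these. -/
lemma FinMod.map_of_ker {K V V' V'' : Type*} [Field K] [AddCommGroup V] [Module K V]
    [AddCommGroup V'] [Module K V'] [AddCommGroup V''] [Module K V''] {S : Submodule K V}
    {D' : Submodule K V'} {D'' : Submodule K V''} (f : V →ₗ[K] V') (g : V →ₗ[K] V'')
    (hf : FinMod (S.map f) D') (hg : FinMod ((S ⊓ D'.comap f).map g) D'') :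
    FinMod (S.map g) D'' := by
  let F : S →ₗ[K] V' ⧸ D' := D'.mkQ ∘ₗ f ∘ₗ S.subtype
  let G : S →ₗ[K] V'' ⧸ D'' := D''.mkQ ∘ₗ g ∘ₗ S.subtype
  have h1 : FiniteDimensional K ((S.map f).map D'.mkQ) := hf
  have h2 : FiniteDimensional K (((S ⊓ D'.comap f).map g).map D''.mkQ) := hg
  have hF : LinearMap.range F ≤ (S.map f).map D'.mkQ := by
    rintro _ ⟨s, rfl⟩
    exact ⟨f s, ⟨s, s.2, rfl⟩, rfl⟩
  have : FiniteDimensional K (LinearMap.range F) := Submodule.finiteDimensional_of_le hF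
  obtain ⟨C, hC⟩ := Submodule.exists_isCompl (LinearMap.ker F)
  have : FiniteDimensional K (S ⧸ LinearMap.ker F) := F.quotKerEquivRange.symm.finiteDimensional
  have : FiniteDimensional K C := (Submodule.quotientEquivOfIsCompl _ _ hC).finiteDimensional
  have hle : (S.map g).map D''.mkQ ≤
      ((S ⊓ D'.comap f).map g).map D''.mkQ ⊔ C.map G := by
    rintro _ ⟨_, ⟨s, hs, rfl⟩, rfl⟩
    have hmem : (⟨s, hs⟩ : S) ∈ LinearMap.ker F ⊔ C := hC.sup_eq_top ▸ Submodule.mem_top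
    obtain ⟨a, ha, c, hc, hac⟩ := Submodule.mem_sup.1 hmem
    refine Submodule.mem_sup.2 ⟨G a, ⟨g a, ⟨a, ⟨a.2, ?_⟩, rfl⟩, rfl⟩, G c, ⟨c, hc, rfl⟩, ?_⟩
    · exact (Submodule.Quotient.mk_eq_zero D').1 ha
    · rw [← map_add, hac]
      rfl
  exact Submodule.finiteDimensional_of_le hle

/-! ### Homology of the kernel of a map onto a free algebra. -/

section

variable {K R X : Type*} [Field K] [Ring R] [Algebra K R] {ε : R →ₐ[K] K}

lemma mem_augRel_of_forall_apply (c : X →₀ R) (hc : ∀ x, ε (c x) = 0) :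
    c ∈ augRel ε (⊤ : Submodule R (X →₀ R)) := by
  classical
  rw [← Finsupp.sum_single c]
  refine Submodule.sum_mem _ fun x _ => ?_
  have : Finsupp.single x (c x) = c x • Finsupp.single x (1 : R) := by simp
  rw [this]
  exact smul_mem_augRel (hc x) Submodule.mem_top

lemma exists_linearCombination_of_mem_augRel {κ : Set R} {v : R}
    (hv : v ∈ augRel ε (Ideal.span κ)) :
    ∃ a : κ →₀ R, (∀ k, ε (a k) = 0) ∧ Finsupp.linearCombination R (fun k : κ => (k : R)) a = v := by
  induction hv using Submodule.span_induction with
  | mem v hv =>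
    obtain ⟨a, z, hz, rfl⟩ := hv
    have hz : z ∈ Submodule.span R κ := hz
    rw [← Subtype.range_coe (s := κ), Finsupp.mem_span_range_iff_exists_finsupp] at hz
    obtain ⟨c, rfl⟩ := hz
    refine ⟨(a - algebraMap K R (ε a)) • c, fun k => ?_, ?_⟩
    · rw [Finsupp.smul_apply, smul_eq_mul, map_mul, map_sub, AlgHom.commutes, Algebra.algebraMap_self,
        RingHom.id_apply, sub_self, zero_mul]
    · rw [map_smul, sub_smul, algebraMap_smul]
      rfl
  | zero => exact ⟨0, by simp, by simp⟩
  | add v w _ _ hv hw =>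
    obtain ⟨a, ha, rfl⟩ := hv
    obtain ⟨b, hb, rfl⟩ := hw
    exact ⟨a + b, fun k => by rw [Finsupp.add_apply, map_add, ha, hb, add_zero], map_add _ _ _⟩
  | smul c v _ hv =>
    obtain ⟨a, ha, rfl⟩ := hv
    refine ⟨c • a, fun k => by rw [Finsupp.smul_apply, map_smul, ha, smul_zero], ?_⟩
    exact ((Finsupp.linearCombination R (fun k : κ => (k : R))).restrictScalars K).map_smul c a

/-- The map from a free module onto the augmentation ideal of `R` determined by generators `y` of a
free quotient and generators `κ` of the kernel. -/
def augCover (y : X → R) (κ : Set R) : ((X →₀ R) × (κ →₀ R)) →ₗ[R] R :=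
  (Finsupp.linearCombination R y).coprod (Finsupp.linearCombination R fun k : κ => (k : R))

variable (π : R →ₐ[K] MonoidAlgebra K (FreeMonoid X)) {y : X → R} {κ : Set R}

lemma map_linearCombination_of (hy : ∀ x, π (y x) = MonoidAlgebra.single (FreeMonoid.of x) 1)
    (c : X →₀ R) : π (Finsupp.linearCombination R y c) =
      (c.mapRange π (map_zero π)).sum fun x a => a * MonoidAlgebra.single (FreeMonoid.of x) 1 := by
  rw [Finsupp.linearCombination_apply, Finsupp.sum_mapRange_index (by simp), Finsupp.sum,
    Finsupp.sum, map_sum]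
  refine Finset.sum_congr rfl fun x _ => ?_
  rw [smul_eq_mul, map_mul, hy]

variable {π}

lemma ker_le_aug (hε : ∀ k ∈ κ, ε k = 0) (hκ : RingHom.ker π = Ideal.span κ) {r : R}
    (hr : π r = 0) : ε r = 0 := by
  have hr : r ∈ Ideal.span κ := hκ ▸ hr
  exact (Ideal.span_le (I := RingHom.ker ε)).2 hε hr

/-- In the free quotient, an element without constant term is a combination of the generators.
Lifting the coefficients leaves an error in `ker π`, which is a combination of `κ`. -/
lemma aug_eq_zero_iff (hπ : Function.Surjective π)
    (hy : ∀ x, π (y x) = MonoidAlgebra.single (FreeMonoid.of x) 1) (hyε : ∀ x, ε (y x) = 0)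
    (hε : ∀ k ∈ κ, ε k = 0) (hκ : RingHom.ker π = Ideal.span κ) (r : R) :
    ε r = 0 ↔ ∃ x, augCover y κ x = r := by
  constructor
  · intro hr
    obtain ⟨c, hc⟩ := FreeMonoidAlgebra.exists_eq_add_sum_mul_of (π r)
    obtain ⟨c, rfl⟩ := Finsupp.mapRange_surjective π (map_zero π) hπ c
    rw [← map_linearCombination_of π hy] at hc
    set t := (π r).coeff 1
    set s := Finsupp.linearCombination R y c with hs
    have hsε : ε s = 0 := by
      rw [hs, Finsupp.linearCombination_apply, Finsupp.sum, map_sum]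
      exact Finset.sum_eq_zero fun x _ => by rw [smul_eq_mul, map_mul, hyε, mul_zero]
    have ht : π (algebraMap K R t) = MonoidAlgebra.single 1 t := by
      rw [AlgHom.commutes]
      rfl
    have hker : π (r - algebraMap K R t - s) = 0 := by
      rw [map_sub, map_sub, ht]
      conv_lhs => rw [hc]
      abel
    have h0 := ker_le_aug hε hκ hker
    rw [map_sub, map_sub, hr, hsε, AlgHom.commutes, sub_zero, zero_sub, neg_eq_zero] at h0
    have h0 : t = 0 := h0
    rw [h0, map_zero, sub_zero] at hker
    have hmem : r - s ∈ Submodule.span R κ := by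
      change r - s ∈ Ideal.span κ
      rw [← hκ]
      exact hker
    rw [← Subtype.range_coe (s := κ), Finsupp.mem_span_range_iff_exists_finsupp] at hmem
    obtain ⟨a, ha⟩ := hmem
    refine ⟨(c, a), ?_⟩
    rw [augCover, LinearMap.coprod_apply, ← hs, Finsupp.linearCombination_apply, ha]
    abel
  · rintro ⟨⟨c, a⟩, rfl⟩
    rw [augCover, LinearMap.coprod_apply, Finsupp.linearCombination_apply,
      Finsupp.linearCombination_apply, Finsupp.sum, Finsupp.sum, map_add, map_sum, map_sum,
      Finset.sum_eq_zero, Finset.sum_eq_zero, add_zero]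
    · exact fun k _ => by rw [smul_eq_mul, map_mul, hε k k.2, mul_zero]
    · exact fun x _ => by rw [smul_eq_mul, map_mul, hyε, mul_zero]

/-- The families of elements of `S` indexed by `X`. -/
def families (X : Type*) (S : Submodule K R) : Submodule K (X →₀ R) :=
  ⨅ x, S.comap (Finsupp.lapply x)

lemma mem_families {S : Submodule K R} {c : X →₀ R} : c ∈ families X S ↔ ∀ x, c x ∈ S := by
  simp [families]

/-- With `B = ker π` and `M = B/ΩB`, the left-hand side is the kernel of `⊕_X M → M`, `(m_x) ↦ ∑ m_x
y_x`. It is the image of the finite-dimensional space of cycles under the first projection; cycles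
have first components in `B` because the letters are left independent in the free algebra. -/
lemma finMod_families (hy : ∀ x, π (y x) = MonoidAlgebra.single (FreeMonoid.of x) 1)
    (hε : ∀ k ∈ κ, ε k = 0) (hκ : RingHom.ker π = Ideal.span κ)
    (h : FinMod ((LinearMap.ker (augCover y κ)).restrictScalars K ⊓ augRel ε ⊤)
      (augRel ε (LinearMap.ker (augCover y κ)))) :
    FinMod (families X ((RingHom.ker π).restrictScalars K) ⊓ (augRel ε (RingHom.ker π)).comap
        ((Finsupp.linearCombination R y).restrictScalars K))
      (families X (augRel ε (RingHom.ker π))) := by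
  refine (h.map ((LinearMap.fst R (X →₀ R) (κ →₀ R)).restrictScalars K)
    (D' := families X (augRel ε (RingHom.ker π))) ?_).mono ?_ le_rfl
  · rintro _ ⟨z, hz, rfl⟩
    rw [mem_families]
    intro x
    refine map_mem_augRel ((Finsupp.lapply x) ∘ₗ LinearMap.fst R (X →₀ R) (κ →₀ R)) ?_ hz
    rintro ⟨c, a⟩ hca
    have hca : Finsupp.linearCombination R y c +
      Finsupp.linearCombination R (fun k : κ => (k : R)) a = 0 := hca
    have ha : π (Finsupp.linearCombination R (fun k : κ => (k : R)) a) = 0 := by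
      change _ ∈ RingHom.ker π
      rw [hκ, Finsupp.linearCombination_apply]
      exact Submodule.sum_mem _ fun k _ => Ideal.mul_mem_left _ _ (Ideal.subset_span k.2)
    have h0 := congrArg π hca
    rw [map_add, ha, add_zero, map_zero, map_linearCombination_of π hy] at h0
    exact FreeMonoidAlgebra.eq_zero_of_sum_mul_of_eq_zero h0 x
  · rintro c ⟨hc, hc'⟩
    refine Submodule.mem_sup_left ?_
    have hc : ∀ x, π (c x) = 0 := fun x => mem_families.1 hc x
    have hc' : Finsupp.linearCombination R y c ∈ augRel ε (RingHom.ker π) := hc'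
    rw [hκ] at hc'
    obtain ⟨a, ha, hac⟩ := exists_linearCombination_of_mem_augRel hc'
    -- The relation `∑ c_x y_x ∈ ΩB` is completed to a cycle by coefficients `a` in `Ω`; those of
    -- `c` are in `B`, hence also in `Ω`.
    refine ⟨(c, -a), ⟨?_, ?_⟩, rfl⟩
    · change augCover y κ (c, -a) = 0
      rw [augCover, LinearMap.coprod_apply, map_neg, hac, add_neg_cancel]
    · have h1 : (c, -a) = LinearMap.inl R (X →₀ R) (κ →₀ R) c -
          LinearMap.inr R (X →₀ R) (κ →₀ R) a := by simp
      rw [h1]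
      exact sub_mem
        (map_mem_augRel _ (fun _ _ => Submodule.mem_top)
          (mem_augRel_of_forall_apply c fun x => ker_le_aug hε hκ (hc x)))
        (map_mem_augRel _ (fun _ _ => Submodule.mem_top) (mem_augRel_of_forall_apply a ha))

/-- If the kernel of a map from `R` onto a free algebra of rank at least two satisfies the
finiteness condition coming from the second homology, and if some element outside of this kernel
annihilates it modulo `augRel`, then it is finite-dimensional modulo `augRel`. -/
lemma finMod_ker [Nontrivial X] (hπ : Function.Surjective π)
    (hy : ∀ x, π (y x) = MonoidAlgebra.single (FreeMonoid.of x) 1)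
    (hker : ∀ r, π r = 0 → ε r = 0)
    (h : FinMod (families X ((RingHom.ker π).restrictScalars K) ⊓ (augRel ε (RingHom.ker π)).comap
        ((Finsupp.linearCombination R y).restrictScalars K))
      (families X (augRel ε (RingHom.ker π))))
    {n : R} (hn : π n ≠ 0) (hn' : ∀ b, π b = 0 → b * n ∈ augRel ε (RingHom.ker π)) :
    FinMod ((RingHom.ker π).restrictScalars K) (augRel ε (RingHom.ker π)) := by
  set B := (RingHom.ker π).restrictScalars K with hB
  set D := augRel ε (RingHom.ker π) with hD
  -- `V a` says that `M a` is finite-dimensional, where `M = B/D`. It depends only on `π a`, because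
  -- `B` lies in the augmentation ideal and so `B * B` lies in `D`.
  let V : R → Prop := fun a => FinMod (B.map (LinearMap.mulRight K a)) D
  have hcoset : ∀ a a', π a = π a' → V a → V a' := by
    intro a a' haa h
    refine FinMod.mono (S' := B.map (LinearMap.mulRight K a)) h ?_ le_rfl
    rintro _ ⟨b, hb, rfl⟩
    refine Submodule.mem_sup.2 ⟨b * a, ⟨b, hb, rfl⟩, b * (a' - a), ?_, ?_⟩
    · refine smul_mem_augRel (hker b hb) ?_
      change π (a' - a) = 0
      rw [map_sub, haa, sub_self]
    · rw [LinearMap.mulRight_apply, ← mul_add, add_sub_cancel]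
  have hone : ∃ r, π r = 1 ∧ V r := by
    refine FreeMonoidAlgebra.one_mem_of_stripRight_mem (P := fun f => ∃ r, π r = f ∧ V r)
      ?_ ?_ ⟨n, rfl, ?_⟩ hn
    · rintro g _ ⟨r, rfl, hr⟩
      obtain ⟨s, rfl⟩ := hπ g
      refine ⟨s * r, map_mul π s r, ?_⟩
      refine FinMod.mono (S' := B.map (LinearMap.mulRight K r)) hr ?_ le_rfl
      rintro _ ⟨b, hb, rfl⟩
      refine Submodule.mem_sup_left ⟨b * s, ?_, ?_⟩
      · have hb : π b = 0 := hb
        change π (b * s) = 0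
        rw [map_mul, hb, zero_mul]
      · rw [LinearMap.mulRight_apply, LinearMap.mulRight_apply, mul_assoc]
    · rintro x _ ⟨r, rfl, hr⟩ hr1
      obtain ⟨c, hc⟩ := FreeMonoidAlgebra.exists_eq_add_sum_mul_of (π r)
      have hcx : FreeMonoidAlgebra.stripRight (FreeMonoid.of x) (π r) = c x := by
        classical
        rw [hr1, MonoidAlgebra.single_zero, zero_add] at hc
        rw [hc, Finsupp.sum, map_sum]
        simp only [FreeMonoidAlgebra.stripRight_mul_of]
        rw [Finset.sum_ite_eq]
        split_ifs with hx
        · rfl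
        · exact (Finsupp.notMem_support_iff.1 hx).symm
      obtain ⟨c, rfl⟩ := Finsupp.mapRange_surjective π (map_zero π) hπ c
      rw [hcx]
      refine ⟨c x, by rw [Finsupp.mapRange_apply], ?_⟩
      rw [hr1, MonoidAlgebra.single_zero, zero_add, ← map_linearCombination_of π hy] at hc
      have hs := hcoset _ _ hc hr
      -- Modulo finitely many dimensions only those `b` with `b * ∑ c_x y_x ∈ D` matter. For these
      -- the family `(b * c_x)` lies in the kernel controlled by `h`, so its component at `x` spans
      -- a finite-dimensional space modulo `D`.
      refine FinMod.map_of_ker (LinearMap.mulRight K (Finsupp.linearCombination R y c))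
        (LinearMap.mulRight K (c x)) hs ?_
      let T : R →ₗ[K] X →₀ R := (LinearMap.toSpanSingleton R (X →₀ R) c).restrictScalars K
      have h1 : FinMod ((B ⊓ D.comap (LinearMap.mulRight K (Finsupp.linearCombination R y c))).map T)
          (families X D) := by
        refine h.mono ?_ le_rfl
        rintro _ ⟨b, ⟨hb, hb'⟩, rfl⟩
        have hb : π b = 0 := hb
        have hb' : b * Finsupp.linearCombination R y c ∈ D := hb'
        refine Submodule.mem_sup_left ⟨?_, ?_⟩
        · rw [SetLike.mem_coe, mem_families]
          intro z
          change π (b * c z) = 0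
          rw [map_mul, hb, zero_mul]
        · change Finsupp.linearCombination R y (b • c) ∈ D
          rwa [map_smul]
      have h2 := h1.map (Finsupp.lapply x) (D' := D) (by
        rintro _ ⟨z, hz, rfl⟩
        exact mem_families.1 hz x)
      rwa [← Submodule.map_comp] at h2
    · refine FinMod.mono (S' := ⊥) (D := D) ?_ ?_ le_rfl
      · change FiniteDimensional K ((⊥ : Submodule K R).map D.mkQ)
        rw [Submodule.map_bot]
        infer_instance
      · rintro _ ⟨b, hb, rfl⟩
        exact Submodule.mem_sup_right (hn' b hb)
  obtain ⟨r, hr, hV⟩ := hone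
  have h1 : FinMod (B.map (LinearMap.mulRight K (1 : R))) D := hcoset r 1 (by rw [hr, map_one]) hV
  rwa [LinearMap.mulRight_one, Submodule.map_id] at h1

end

open UniversalEnvelopingAlgebra in
-- A free algebra on at most one letter is commutative, and the Lie algebra embeds into its
-- enveloping algebra.
lemma nontrivial_of_not_isLieAbelian {K : Type u} [Field K] {F : Type v} [LieRing F]
    [LieAlgebra K F] {X : Set F}
    (e : UniversalEnvelopingAlgebra K F ≃ₐ[K] MonoidAlgebra K (FreeMonoid X))
    (h : ¬ IsLieAbelian F) : Nontrivial X := by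
  rw [← not_subsingleton_iff_nontrivial]
  intro _
  refine h ⟨fun a b => ι_injective K F ?_⟩
  have comm : ∀ f g : MonoidAlgebra K (FreeMonoid X), f * g = g * f := by
    intro f g
    induction f using MonoidAlgebra.induction_linear with
    | zero => simp
    | add f f' hf hf' => rw [add_mul, mul_add, hf, hf']
    | single w r =>
      induction g using MonoidAlgebra.induction_linear with
      | zero => simp
      | add f f' hf hf' => rw [add_mul, mul_add, hf, hf']
      | single w' r' =>
        have hw : w * w' = w' * w := FreeMonoid.toList.injective (by
          rw [FreeMonoid.toList_mul, FreeMonoid.toList_mul]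
          exact List.ext_getElem (by simp [add_comm]) fun _ _ _ => Subsingleton.elim _ _)
        rw [MonoidAlgebra.single_mul_single, MonoidAlgebra.single_mul_single, hw, mul_comm r]
  have h1 : ι K a * ι K b = ι K b * ι K a := e.injective (by rw [map_mul, map_mul, comm])
  rw [PBW.ι_mul_ι, add_eq_left] at h1
  rw [h1, map_zero]

lemma FinMod.map_ideal {K R S : Type*} [Field K] [Ring R] [Algebra K R] [Ring S] [Algebra K S]
    (Θ : R →ₐ[K] S) {ε : R →ₐ[K] K} {ε' : S →ₐ[K] K} (hε : ∀ r, ε' (Θ r) = ε r) {I : Ideal R}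
    {J : Ideal S} (hI : ∀ b ∈ I, Θ b ∈ J) (hJ : ∀ z ∈ J, ∃ b ∈ I, Θ b = z)
    (h : FinMod (I.restrictScalars K) (augRel ε I)) :
    FinMod (J.restrictScalars K) (augRel ε' J) := by
  refine (h.map Θ.toLinearMap (D' := augRel ε' J) ?_).mono ?_ le_rfl
  · rw [Submodule.map_le_iff_le_comap]
    refine Submodule.span_le.2 ?_
    rintro _ ⟨r, b, hb, rfl⟩
    refine Submodule.subset_span ⟨Θ r, Θ b, hI b hb, ?_⟩
    rw [hε, smul_eq_mul, smul_eq_mul, AlgHom.toLinearMap_apply, map_sub, map_mul, map_smul]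
  · intro z hz
    obtain ⟨b, hb, rfl⟩ := hJ z hz
    exact Submodule.mem_sup_left ⟨b, hb, rfl⟩

/-! ### The kernel of one projection maps onto the other factor. -/

section Surjectivity

variable {K : Type u} [Field K] {L F G : Type v} [LieRing L] [LieAlgebra K L]
  [LieRing F] [LieAlgebra K F] [LieRing G] [LieAlgebra K G]

open UniversalEnvelopingAlgebra LieHomology

/-- Let `f` be a map from `L` onto a non-abelian free Lie algebra whose kernel is centralized by an
element outside of the kernel. If the second homology of `L` is finite-dimensional, then so is the
first homology of the kernel of `f`. -/
lemma finMod_ker_map (hH2 : Module.Finite K (homology K L 2 (trivialModule K L)))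
    (hF : IsFreeLie K F) (hna : ¬ IsLieAbelian F) (f : L →ₗ⁅K⁆ F) (hf : Function.Surjective f)
    {n : L} (hn : f n ≠ 0) (hcomm : ∀ l, f l = 0 → ⁅l, n⁆ = 0) :
    FinMod ((RingHom.ker (UniversalEnvelopingAlgebra.map f)).restrictScalars K)
      (augRel (augmentation K L) (RingHom.ker (UniversalEnvelopingAlgebra.map f))) := by
  obtain ⟨X, hX⟩ := hF
  obtain ⟨e, he⟩ := exists_algEquiv_of_bijective_lift hX
  have hXn := nontrivial_of_not_isLieAbelian e hna
  let π : UniversalEnvelopingAlgebra K L →ₐ[K] MonoidAlgebra K (FreeMonoid X) :=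
    (e : UniversalEnvelopingAlgebra K F →ₐ[K] _).comp (UniversalEnvelopingAlgebra.map f)
  have hπ : Function.Surjective π := e.surjective.comp (map_surjective hf)
  have hπ0 : ∀ r, π r = 0 ↔ UniversalEnvelopingAlgebra.map f r = 0 := fun r => e.map_eq_zero_iff
  have hker : RingHom.ker π = RingHom.ker (UniversalEnvelopingAlgebra.map f) := by
    ext r
    exact hπ0 r
  let y : X → UniversalEnvelopingAlgebra K L := fun x => ι K (Function.surjInv hf x)
  have hy : ∀ x, π (y x) = MonoidAlgebra.single (FreeMonoid.of x) 1 := by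
    intro x
    change e (UniversalEnvelopingAlgebra.map f (ι K _)) = _
    rw [map_ι, Function.surjInv_eq hf, he]
  have hyε : ∀ x, augmentation K L (y x) = 0 := fun x => augmentation_ι _
  have hε : ∀ k ∈ (ι K : L → UniversalEnvelopingAlgebra K L) '' {x | f x = 0},
      augmentation K L k = 0 := by
    rintro _ ⟨x, _, rfl⟩
    exact augmentation_ι x
  have hκ : RingHom.ker π = Ideal.span ((ι K : L → UniversalEnvelopingAlgebra K L) '' {x | f x = 0}) :=
    hker.trans (ker_map hf)
  have hcyc := finMod_cycles hH2 (augCover y _) (aug_eq_zero_iff hπ hy hyε hε hκ)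
  have key := finMod_ker hπ hy (fun r hr => ker_le_aug hε hκ hr) (finMod_families hy hε hκ hcyc)
    (n := ι K n) ?_ ?_
  · rwa [hker] at key
  · rw [Ne, hπ0, map_ι]
    exact fun h => hn (ι_injective K F (by rw [h, map_zero]))
  · intro b hb
    have hb' : b ∈ Ideal.span ((ι K : L → UniversalEnvelopingAlgebra K L) '' {x | f x = 0}) :=
      hκ ▸ hb
    clear hb
    induction hb' using Submodule.span_induction with
    | mem v hv =>
      obtain ⟨x, hx, rfl⟩ := hv
      have hx : f x = 0 := hx
      -- A generator `x` of `B` commutes with `n`, so `x n = n x` lies in `ΩB`.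
      rw [PBW.ι_mul_ι, hcomm x hx, map_zero, add_zero]
      refine smul_mem_augRel (augmentation_ι n) ?_
      rw [hker]
      change UniversalEnvelopingAlgebra.map f _ = 0
      rw [map_ι, hx, map_zero]
    | zero => rw [zero_mul]; exact zero_mem _
    | add v w _ _ hv hw => rw [add_mul]; exact add_mem hv hw
    | smul a v _ hv =>
      rw [smul_eq_mul, mul_assoc]
      have h1 : a * (v * ι K n) = (a • (v * ι K n) - augmentation K L a • (v * ι K n)) +
          augmentation K L a • (v * ι K n) := by rw [sub_add_cancel, smul_eq_mul]
      rw [h1]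
      have h2 : v * ι K n ∈ (RingHom.ker π).restrictScalars K := augRel_le hv
      exact add_mem (Submodule.subset_span ⟨a, _, h2, rfl⟩) (Submodule.smul_mem _ _ hv)

/-- A nonzero ideal of a free Lie algebra whose first homology is finite-dimensional is the whole
Lie algebra; the ideal is given here as the image of the kernel of `f`. -/
lemma exists_map_eq_of_finMod (hG : IsFreeLie K G) (f : L →ₗ⁅K⁆ F) (hf : Function.Surjective f)
    (g : L →ₗ⁅K⁆ G) (hg : Function.Surjective g)
    (h : FinMod ((RingHom.ker (UniversalEnvelopingAlgebra.map f)).restrictScalars K)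
      (augRel (augmentation K L) (RingHom.ker (UniversalEnvelopingAlgebra.map f))))
    {m : L} (hm : f m = 0) (hm' : g m ≠ 0) (a : G) : ∃ l, f l = 0 ∧ g l = a := by
  obtain ⟨X, hX⟩ := hG
  obtain ⟨e, he⟩ := exists_algEquiv_of_bijective_lift hX
  let I : LieIdeal K G :=
    { ((f : L →ₗ[K] F).ker).map (g : L →ₗ[K] G) with
      lie_mem := by
        rintro x _ ⟨l, hl, rfl⟩
        obtain ⟨l', rfl⟩ := hg x
        refine ⟨⁅l', l⁆, ?_, LieHom.map_lie g l' l⟩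
        have hl : f l = 0 := hl
        change f ⁅l', l⁆ = 0
        rw [LieHom.map_lie, hl, lie_zero] }
  have hI : ∀ x, x ∈ I ↔ ∃ l, f l = 0 ∧ g l = x := fun x => Iff.rfl
  by_contra hcon
  rw [← hI] at hcon
  let p : G →ₗ⁅K⁆ G ⧸ I :=
    { (LieSubmodule.Quotient.mk' I : G →ₗ[K] G ⧸ I) with
      map_lie' := fun {x y} => LieSubmodule.Quotient.mk_bracket I x y }
  have hp : Function.Surjective p := LieSubmodule.Quotient.surjective_mk' I
  have hp0 : ∀ x, p x = 0 ↔ x ∈ I := fun x => LieSubmodule.Quotient.mk_eq_zero I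
  -- As `I` is assumed proper, the enveloping algebra of `G ⧸ I` is infinite-dimensional. Finiteness
  -- passes from the kernel for `f` to the kernel of `q`, since the former maps onto the latter; the
  -- resulting injectivity of `q` contradicts that it kills the nonzero image of `m`.
  have hQ : Nontrivial (G ⧸ I) := ⟨⟨p a, 0, fun h => hcon ((hp0 a).1 h)⟩⟩
  let q : MonoidAlgebra K (FreeMonoid X) →ₐ[K] UniversalEnvelopingAlgebra K (G ⧸ I) :=
    (UniversalEnvelopingAlgebra.map p).comp
      (e.symm : MonoidAlgebra K (FreeMonoid X) →ₐ[K] UniversalEnvelopingAlgebra K G)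
  have hq : Function.Surjective q := (map_surjective hp).comp e.symm.surjective
  have haug : ∀ z, FreeMonoidAlgebra.aug z = augmentation K G (e.symm z) := by
    intro z
    have : FreeMonoidAlgebra.aug = (augmentation K G).comp
        (e.symm : MonoidAlgebra K (FreeMonoid X) →ₐ[K] UniversalEnvelopingAlgebra K G) := by
      refine MonoidAlgebra.algHom_ext' (FreeMonoid.hom_eq fun x => ?_) (by ext)
      change FreeMonoidAlgebra.aug (MonoidAlgebra.single (FreeMonoid.of x) 1) =
        augmentation K G (e.symm (MonoidAlgebra.single (FreeMonoid.of x) 1))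
      rw [← he, e.symm_apply_apply, augmentation_ι, FreeMonoidAlgebra.aug, he,
        MonoidAlgebra.lift_single, FreeMonoid.lift_eval_of, smul_zero]
    exact AlgHom.congr_fun this z
  let Θ : UniversalEnvelopingAlgebra K L →ₐ[K] MonoidAlgebra K (FreeMonoid X) :=
    (e : UniversalEnvelopingAlgebra K G →ₐ[K] _).comp (UniversalEnvelopingAlgebra.map g)
  have hΘ : Function.Surjective Θ := e.surjective.comp (map_surjective hg)
  have hqΘ : ∀ r, q (Θ r) =
      UniversalEnvelopingAlgebra.map p (UniversalEnvelopingAlgebra.map g r) := fun r =>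
    congrArg _ (e.symm_apply_apply _)
  have haugΘ : ∀ r, FreeMonoidAlgebra.aug (Θ r) = augmentation K L r := fun r => by
    rw [haug]
    exact (congrArg _ (e.symm_apply_apply _)).trans (augmentation_map g r)
  have hkerΘ : ∀ b, b ∈ RingHom.ker (UniversalEnvelopingAlgebra.map f) → q (Θ b) = 0 := by
    intro b hb
    rw [ker_map hf] at hb
    have hle : Ideal.span ((ι K : L → UniversalEnvelopingAlgebra K L) '' {x | f x = 0}) ≤
        RingHom.ker (q.comp Θ) := by
      refine Ideal.span_le.2 ?_
      rintro _ ⟨x, hx, rfl⟩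
      change q (Θ _) = 0
      rw [hqΘ, map_ι, map_ι, (hp0 _).2 ((hI _).2 ⟨x, hx, rfl⟩), map_zero]
    exact hle hb
  have hfin : FinMod ((RingHom.ker q).restrictScalars K)
      (augRel FreeMonoidAlgebra.aug (RingHom.ker q)) := by
    refine FinMod.map_ideal Θ haugΘ hkerΘ ?_ h
    intro z hz
    have hz : e.symm z ∈ RingHom.ker (UniversalEnvelopingAlgebra.map p) := hz
    rw [ker_map hp] at hz
    have hmem : ∀ w, w ∈ Ideal.span ((ι K : G → UniversalEnvelopingAlgebra K G) '' {x | p x = 0}) →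
        ∃ b ∈ RingHom.ker (UniversalEnvelopingAlgebra.map f),
          UniversalEnvelopingAlgebra.map g b = w := by
      intro w hw
      induction hw using Submodule.span_induction with
      | mem w hw =>
        obtain ⟨x, hx, rfl⟩ := hw
        obtain ⟨l, hl, rfl⟩ := (hI x).1 ((hp0 x).1 hx)
        refine ⟨ι K l, ?_, map_ι g l⟩
        change UniversalEnvelopingAlgebra.map f _ = 0
        rw [map_ι, hl, map_zero]
      | zero => exact ⟨0, zero_mem _, map_zero _⟩
      | add v w _ _ hv hw =>
        obtain ⟨b, hb, rfl⟩ := hv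
        obtain ⟨c, hc, rfl⟩ := hw
        exact ⟨b + c, add_mem hb hc, map_add _ _ _⟩
      | smul r w _ hw =>
        obtain ⟨b, hb, rfl⟩ := hw
        obtain ⟨s, rfl⟩ := map_surjective hg r
        exact ⟨s * b, Ideal.mul_mem_left _ _ hb, map_mul _ _ _⟩
    obtain ⟨b, hb, hbz⟩ := hmem _ hz
    refine ⟨b, hb, ?_⟩
    change e (UniversalEnvelopingAlgebra.map g b) = z
    rw [hbz, e.apply_symm_apply]
  have hinj := FreeMonoidAlgebra.injective_of_finMod_ker q hq
    (UniversalEnvelopingAlgebra.not_finite K (G ⧸ I)) (fun z hz => by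
      rw [haug, ← augmentation_map p]
      exact (congrArg _ hz).trans (map_zero _)) hfin
  have h0 : Θ (ι K m) = 0 := hinj (by
    rw [map_zero]
    refine hkerΘ _ ?_
    change UniversalEnvelopingAlgebra.map f _ = 0
    rw [map_ι, hm, map_zero])
  have h1 : UniversalEnvelopingAlgebra.map g (ι K m) = 0 := e.map_eq_zero_iff.1 h0
  rw [map_ι] at h1
  exact hm' (ι_injective K G (by rw [h1, map_zero]))

end Surjectivity

/-! ### Subdirect sums. -/

/-- If `L` contains, for all `i ≠ j` and all `x ∈ F j`, an element with components `0` at `i` and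
`x` at `j`, then the elements of the lower central series of `F j` are components at `j` of elements
of `L` vanishing at many other places. -/
lemma exists_mem_of_mem_lowerCentralSeries {K : Type u} [Field K] {k : ℕ} {F : Fin k → Type v}
    [∀ i, LieRing (F i)] [∀ i, LieAlgebra K (F i)] (L : LieSubalgebra K (⨁ i, F i))
    (h : ∀ i j, i ≠ j → ∀ x : F j, ∃ l ∈ L, l i = 0 ∧ l j = x) (j : Fin k) (n : ℕ) :
    ∀ s : Finset (Fin k), j ∉ s → s.card = n + 1 →
      ∀ x ∈ LieModule.lowerCentralSeries K (F j) (F j) n, ∃ l ∈ L, (∀ i ∈ s, l i = 0) ∧ l j = x := by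
  induction n with
  | zero =>
    intro s hj hs x _
    obtain ⟨i, rfl⟩ := Finset.card_eq_one.1 hs
    obtain ⟨l, hl, hli, hlj⟩ := h i j (fun hij => hj (by simp [hij])) x
    exact ⟨l, hl, fun i' hi' => by rwa [Finset.mem_singleton.1 hi'], hlj⟩
  | succ n ih =>
    intro s hj hs x hx
    obtain ⟨i, s, his, rfl, hs'⟩ := Finset.card_eq_succ.1 hs
    have hij : i ≠ j := fun hij => hj (by simp [hij])
    have hjs : j ∉ s := fun h => hj (Finset.mem_insert_of_mem h)
    rw [LieModule.lowerCentralSeries_succ, ← LieSubmodule.mem_toSubmodule,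
      LieSubmodule.lieIdeal_oper_eq_linear_span'] at hx
    induction hx using Submodule.span_induction with
    | mem x hx =>
      obtain ⟨a, _, b, hb, rfl⟩ := hx
      obtain ⟨l, hl, hli, hlj⟩ := h i j hij a
      obtain ⟨l', hl', hli', hlj'⟩ := ih s hjs hs' b hb
      -- Brackets are taken componentwise: `l` takes care of the place `i` and `l'` of the places in
      -- `s`.
      refine ⟨⁅l, l'⁆, L.lie_mem hl hl', fun t ht => ?_, ?_⟩
      · rw [DirectSum.bracket_apply]
        rcases Finset.mem_insert.1 ht with rfl | ht
        · rw [hli, zero_lie]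
        · rw [hli' t ht, lie_zero]
      · rw [DirectSum.bracket_apply, hlj, hlj']
    | zero => exact ⟨0, L.zero_mem, fun _ _ => rfl, rfl⟩
    | add x y _ _ hx hy =>
      obtain ⟨l, hl, hl0, rfl⟩ := hx
      obtain ⟨l', hl', hl0', rfl⟩ := hy
      exact ⟨l + l', L.add_mem hl hl', fun t ht => by
        rw [DirectSum.add_apply, hl0 t ht, hl0' t ht, add_zero], DirectSum.add_apply _ _ _⟩
    | smul c x _ hx =>
      obtain ⟨l, hl, hl0, rfl⟩ := hx
      exact ⟨c • l, L.smul_mem c hl, fun t ht => by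
        rw [DirectSum.smul_apply, hl0 t ht, smul_zero], DirectSum.smul_apply _ _ _⟩

end

theorem mainTheorem2 {K : Type u} [Field K] {k : ℕ} (F : Fin k → Type v)
    [∀ i, LieRing (F i)] [∀ i, LieAlgebra K (F i)]
    (hfree : ∀ i, IsFreeLie K (F i))
    (hfg : ∀ i, IsFGLie K (F i))
    (hnonab : ∀ i, ¬ IsLieAbelian (F i))
    (L : LieSubalgebra K (⨁ i, F i))
    (hsub : ∀ i, L.map (DirectSum.lieAlgebraComponent K (Fin k) F i) = ⊤)
    (hmeet : ∀ i, L ⊓ (DirectSum.lieAlgebraOf K (Fin k) F i).range ≠ ⊥)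
    (hLfg : IsFGLie K L)
    (hH2 : Module.Finite K (LieHomology.homology K L 2 (LieHomology.trivialModule K L))) :
    (∀ i j : Fin k, i < j →
      L.map ((DirectSum.lieAlgebraComponent K (Fin k) F i).prod
        (DirectSum.lieAlgebraComponent K (Fin k) F j)) = ⊤) ∧
    (∀ i : Fin k, ∀ x ∈ lieGamma K (F i) (k - 1),
      DirectSum.lieAlgebraOf K (Fin k) F i x ∈ L) := by
  let p : ∀ i, L →ₗ⁅K⁆ F i := fun i => (DirectSum.lieAlgebraComponent K (Fin k) F i).comp L.incl
  have hp : ∀ i (l : L), p i l = (l : ⨁ i, F i) i := fun i l => rfl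
  have hsurj : ∀ i, Function.Surjective (p i) := by
    intro i x
    have hx : x ∈ L.map (DirectSum.lieAlgebraComponent K (Fin k) F i) := by
      rw [hsub i]; exact LieSubalgebra.mem_top x
    obtain ⟨l, hl, rfl⟩ := (LieSubalgebra.mem_map _ _ _).1 hx
    exact ⟨⟨l, hl⟩, rfl⟩
  have hmeet' : ∀ i, ∃ l : L, p i l ≠ 0 ∧ ∀ j, j ≠ i → p j l = 0 := by
    intro i
    by_contra! hcon
    refine hmeet i (eq_bot_iff.2 ?_)
    rintro _ ⟨hl, ⟨x, rfl⟩⟩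
    have h0 : ∀ j, j ≠ i → DirectSum.of F i x j = 0 := fun j hj => DirectSum.of_eq_of_ne i j x hj
    by_cases hx : x = 0
    · rw [hx]
      exact map_zero (DirectSum.lieAlgebraOf K (Fin k) F i)
    · obtain ⟨j, hj, hj'⟩ := hcon ⟨DirectSum.of F i x, hl⟩ (by
        rw [hp]
        change DirectSum.of F i x i ≠ 0
        rwa [DirectSum.of_eq_same])
      exact absurd (h0 j hj) hj'
  have key : ∀ i j, i ≠ j → ∀ x : F j, ∃ l ∈ L, l i = 0 ∧ l j = x := by
    intro i j hij x
    obtain ⟨n, hn, hn'⟩ := hmeet' i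
    obtain ⟨m, hm, hm'⟩ := hmeet' j
    -- The element `n` is supported at `i` alone and elements of the kernel vanish there, so they
    -- commute.
    have hfin := finMod_ker_map hH2 (hfree i) (hnonab i) (p i) (hsurj i) hn fun l hl => by
      refine Subtype.ext (DFinsupp.ext fun t => ?_)
      change ⁅(l : ⨁ i, F i), (n : ⨁ i, F i)⁆ t = 0
      rw [DirectSum.bracket_apply]
      by_cases ht : t = i
      · subst ht
        rw [← hp, hl, zero_lie]
      · rw [← hp t n, hn' t ht, lie_zero]
    obtain ⟨l, hl, hl'⟩ := exists_map_eq_of_finMod (hfree j) (p i) (hsurj i) (p j) (hsurj j) hfin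
      (hm' i hij) hm x
    exact ⟨l, l.2, hl, hl'⟩
  refine ⟨fun i j hij => eq_top_iff.2 ?_, fun j x hx => ?_⟩
  · rintro ⟨a, b⟩ _
    obtain ⟨l, hl⟩ := hsurj i a
    obtain ⟨l', hl', h0, h1⟩ := key i j hij.ne (b - p j l)
    refine (LieSubalgebra.mem_map _ _ _).2 ⟨l + l', L.add_mem l.2 hl', Prod.ext ?_ ?_⟩
    · change ((l : ⨁ i, F i) + l') i = a
      rw [DirectSum.add_apply, h0, add_zero, ← hp, hl]
    · change ((l : ⨁ i, F i) + l') j = b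
      rw [DirectSum.add_apply, h1, ← hp, add_sub_cancel]
  · obtain ⟨l, hl, hl0, hlj⟩ : ∃ l ∈ L, (∀ i ∈ Finset.univ.erase j, l i = 0) ∧ l j = x := by
      have hcard : (Finset.univ.erase j).card = k - 1 := by
        rw [Finset.card_erase_of_mem (Finset.mem_univ j), Finset.card_fin]
      -- For `k = 1` no component has to vanish and surjectivity of the projection suffices.
      -- Otherwise `γ_{k-1}` has index `k - 2 = n` in `lowerCentralSeries`, matching the `n + 1`
      -- places to be killed.
      rcases hk : k - 1 with _ | n
      · obtain ⟨l, hl⟩ := hsurj j x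
        rw [hk, Finset.card_eq_zero] at hcard
        exact ⟨l, l.2, by rw [hcard]; simp, hl⟩
      · rw [hk] at hx hcard
        exact exists_mem_of_mem_lowerCentralSeries L key j n _ (Finset.notMem_erase j _) hcard x hx
    have : DirectSum.lieAlgebraOf K (Fin k) F j x = l := by
      refine DFinsupp.ext fun t => ?_
      change DirectSum.of F j x t = l t
      by_cases ht : t = j
      · subst ht
        rw [DirectSum.of_eq_same, hlj]
      · rw [DirectSum.of_eq_of_ne j t x ht, hl0 t (Finset.mem_erase.2 ⟨ht, Finset.mem_univ t⟩)]
    rw [this]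
    exact hl
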